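/- Throughout, $n$ runs over the positive multiples of $4$. Let $G = G(n, n/2, n/4)$ be the graph whose vertices are the vectors $x \in \{0,1\}^n$ with exactly $n/2$ coordinates equal to $1$, two vertices $x, y$ being adjacent if and only if $\langle x, y\rangle = n/4$ (Euclidean inner product); it has $N = N(n) = \binom{n}{n/2}$ vertices. For $p = p(n) \in [0,1]$ let $G_p$ be the random spanning subgraph of $G$ in which every edge of $G$ is kept with probability $p$ independently of the others, i.e. $\mathsf{P}(G_p = G') = p^{|E(G')|}(1-p)^{|E(G)| - |E(G')|}$ for every spanning subgraph $G'$ of $G$. For functions of $n$, $f \ll g$ (equivalently $g \gg f$) means that $f/g \to 0$ as $n \to \infty$. Let $F$ be a fixed finite graph with at least one edge, let $$\rho^{\max}(F) = \max_{H \subseteq F,\ v(H) \neq 0} \frac{e(H)}{v(H)},$$ where $v(H)$ and $e(H)$ are the numbers of vertices and edges of the subgraph $H$, and let $X_F$ be the number of copies of $F$ in $G_p$, i.e. of (not necessarily induced) subgraphs of $G_p$ isomorphic to $F$. Put $$p^* = p^*(n) = N^{-1/\rho^{\max}(F)} \sqrt{\ln N}.$$ Then $p^*$ is a threshold probability for the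 property that $G_p$ contains a copy of $F$: if $p \ll p^*$, then $\mathsf{P}(G_p \text{ contains a copy of } F) \to 0$ as $n \to \infty$, and if $p \gg p^*$, then $\mathsf{P}(G_p \text{ contains a copy of } F) \to 1$. Moreover, if $p \gg p^*$, then for every $\varepsilon > 0$ $$\mathsf{P}\left( \left| \frac{X_F}{\mathsf{E} X_F} - 1 \right| < \varepsilon \right) \to 1 \quad (n \to \infty).$$ -/

import Mathlib

open Filter Topology Asymptotics
open scoped SimpleGraph

namespace RandomDistanceGraph

/-- The vertices of the distance graph `G(n, r, s)`: the vectors of `{0, 1}ⁿ` with exactly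
`r` coordinates equal to `1`. -/
abbrev Vertex (n r : ℕ) : Type :=
  {x : Fin n → Fin 2 // ∑ i, (x i : ℕ) = r}

/-- The complete distance graph `G(n, r, s)`: two distinct vertices are adjacent iff their
Euclidean inner product equals `s`. -/
def distanceGraph (n r s : ℕ) : SimpleGraph (Vertex n r) where
  Adj x y := x ≠ y ∧ ∑ i, (x.1 i : ℕ) * (y.1 i : ℕ) = s
  symm := ⟨fun x y h => ⟨h.1.symm, by simpa only [mul_comm] using h.2⟩⟩
  loopless := ⟨fun _ h => h.1 rfl⟩

section RandomSubgraph

variable {V : Type*} [Fintype V]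

/-- The probability `p^|E'| (1 - p)^(|E| - |E'|)` that the random spanning subgraph of `G`,
in which each edge of `G` is kept independently with probability `p`, equals the spanning
subgraph `H ≤ G`. -/
noncomputable def weight (G : SimpleGraph V) (p : ℝ) (H : SimpleGraph V) : ℝ :=
  p ^ H.edgeSet.ncard * (1 - p) ^ (G.edgeSet.ncard - H.edgeSet.ncard)

open Classical in
/-- The (finite) sample space: all spanning subgraphs of `G`. -/
noncomputable def spanningSubgraphs (G : SimpleGraph V) : Finset (SimpleGraph V) :=
  Finset.univ.filter fun H => H ≤ G

open Classical in
/-- The probability of the event `A` for the random spanning subgraph of `G`. -/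
noncomputable def prob (G : SimpleGraph V) (p : ℝ) (A : SimpleGraph V → Prop) : ℝ :=
  ∑ H ∈ (spanningSubgraphs G).filter A, weight G p H

/-- The expectation of the random variable `X` for the random spanning subgraph of `G`. -/
noncomputable def expect (G : SimpleGraph V) (p : ℝ) (X : SimpleGraph V → ℝ) : ℝ :=
  ∑ H ∈ spanningSubgraphs G, weight G p H * X H

/-- The weights of the spanning subgraphs add up to `1`. -/
theorem sum_weight (G : SimpleGraph V) (p : ℝ) :
    ∑ H ∈ spanningSubgraphs G, weight G p H = 1 := by
  classical
  have h := Finset.sum_pow_mul_eq_add_pow p (1 - p) G.edgeFinset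
  rw [add_sub_cancel, one_pow] at h
  rw [← h]
  refine Finset.sum_bij' (fun H _ => H.edgeFinset)
    (fun t _ => SimpleGraph.fromEdgeSet (t : Set (Sym2 V))) ?_ ?_ ?_ ?_ ?_
  · intro H hH
    simpa [spanningSubgraphs] using hH
  · intro t ht
    simp only [spanningSubgraphs, Finset.mem_filter, Finset.mem_univ, true_and]
    rw [Finset.mem_powerset] at ht
    intro a b hab
    rw [SimpleGraph.fromEdgeSet_adj] at hab
    simpa using ht (Finset.mem_coe.1 hab.1)
  · intro H _
    simp
  · intro t ht
    rw [Finset.mem_powerset] at ht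
    ext e
    simp only [SimpleGraph.mem_edgeFinset, SimpleGraph.edgeSet_fromEdgeSet, Set.mem_sdiff,
      Finset.mem_coe]
    refine ⟨fun h => h.1, fun h => ⟨h, ?_⟩⟩
    exact G.not_isDiag_of_mem_edgeSet (by simpa using ht h)
  · intro H _
    simp only [weight]
    rw [← SimpleGraph.coe_edgeFinset H, ← SimpleGraph.coe_edgeFinset G,
      Set.ncard_coe_finset, Set.ncard_coe_finset]

end RandomSubgraph

/-- The graph `G(n, n/2, n/4)`; it is used only for `n` divisible by `4`. -/
abbrev graph (n : ℕ) : SimpleGraph (Vertex n (n / 2)) :=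
  distanceGraph n (n / 2) (n / 4)

/-- The limit `n → ∞` along the multiples of `4`. -/
def toInfinity : Filter ℕ := atTop ⊓ 𝓟 {n | 4 ∣ n}

/-- `pStar` is a threshold probability for the (increasing) property `A` of the random distance
graph `G_p(n, n/2, n/4)`: the probability of `A` tends to `0` for `p ≪ pStar` and to `1` for
`p ≫ pStar`. -/
def IsThresholdProbability (A : ∀ n, SimpleGraph (Vertex n (n / 2)) → Prop)
    (pStar : ℕ → ℝ) : Prop :=
  (∀ p : ℕ → ℝ, (∀ n, p n ∈ Set.Icc (0 : ℝ) 1) → p =o[toInfinity] pStar →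
    Tendsto (fun n => prob (graph n) (p n) (A n)) toInfinity (𝓝 0)) ∧
  (∀ p : ℕ → ℝ, (∀ n, p n ∈ Set.Icc (0 : ℝ) 1) → pStar =o[toInfinity] p →
    Tendsto (fun n => prob (graph n) (p n) (A n)) toInfinity (𝓝 1))

/-- The maximal density `max e(H) / v(H)` over the subgraphs `H` of `F` with `v(H) ≠ 0`. -/
noncomputable def maxDensity {W : Type*} (F : SimpleGraph W) : ℝ :=
  ⨆ H : {H : F.Subgraph // H.verts.Nonempty},
    (H.1.edgeSet.ncard : ℝ) / (H.1.verts.ncard : ℝ)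

/-- The number `N` of vertices of `G(n, n/2, n/4)`. -/
def numVertices (n : ℕ) : ℕ := n.choose (n / 2)

/-- The function `N^(-1/ρ^max(F)) √(ln N)`. -/
noncomputable def threshold {W : Type*} (F : SimpleGraph W) (n : ℕ) : ℝ :=
  (numVertices n : ℝ) ^ (-1 / maxDensity F) * Real.sqrt (Real.log (numVertices n))

/-- The number `X_F` of copies of `F` in `H`: the number of (not necessarily induced) subgraphs
of `H` isomorphic to `F`. -/
noncomputable def numCopies {W : Type*} (F : SimpleGraph W) {V : Type*} [Fintype V]
    (H : SimpleGraph V) : ℝ :=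
  (H.copyCount F : ℝ)

end RandomDistanceGraph

/-! For counting fixed subgraphs, the distance graph behaves like a graph of edge density of order
1/√n, that is 1/√(ln N). A fixed graph with v vertices and e edges has O(N^v / √(ln N)^e)
homomorphisms into it (`exists_card_homs_le`), and at least a constant times as many injective ones
(`exists_le_card_injHoms`). After multiplication by p^e this order becomes N^(v - e/ρ) (p/p*)^e with
ρ the maximal density (`homOrder_mul_pow`), and both halves of the threshold follow by moments.

The counts come from placing the vertices one at a time, as subsets of `Fin n` of size n/2. The d
sets already placed and adjacent to the new one cut `Fin n` into 2^d joint classes. The new set is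
described by how many points it takes from each class, subject to d + 1 independent linear
equations. If all classes have linear size, each equation costs a factor of order √n, so there are
about 2^n/√n^(d+1) choices (`card_extensions_le`, `exists_le_card_extensions`). Families with a
small class are exponentially rare (`exists_card_small_class_le`), whereas the main terms lose only
powers of n, so they can be ignored.

Below p*, a densest subgraph H of F has v(H) - e(H)/ρ = 0, so its expected number of copies is
O((p/p*)^e(H)) and Markov's inequality suffices. Above p*, the variance is controlled by pairs of
embeddings of F that share an edge. If they meet in a subgraph H, their union has 2v(F) - v(H)
vertices and 2e(F) - e(H) edges, so relative to the squared mean they contribute the inverse of the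
order for H. That order is at least p/p* because e(H) ≤ ρ v(H), and Chebyshev's inequality finishes.
Passing from embeddings to copies only divides by the number of automorphisms. -/

namespace RandomDistanceGraph

/-! ### Binomial coefficients at and near the centre of a row. -/

section Binomial

/-- By the recursion for central coefficients, the induction step reduces to (2m+1)(2m+3) ≤ (2m+2)².
-/
theorem centralBinom_sq_mul_le (m : ℕ) : m.centralBinom ^ 2 * (2 * m + 1) ≤ 4 ^ (2 * m) := by
  induction m with
  | zero => simp
  | succ m ih =>
    have h := Nat.succ_mul_centralBinom_succ m
    have hpos : 0 < (m + 1) ^ 2 := by positivity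
    refine Nat.le_of_mul_le_mul_left ?_ hpos
    calc (m + 1) ^ 2 * ((m + 1).centralBinom ^ 2 * (2 * (m + 1) + 1))
        = ((m + 1) * (m + 1).centralBinom) ^ 2 * (2 * m + 3) := by ring
      _ = 4 * (2 * m + 1) * (2 * m + 3) * (m.centralBinom ^ 2 * (2 * m + 1)) := by rw [h]; ring
      _ ≤ 4 * (2 * m + 1) * (2 * m + 3) * 4 ^ (2 * m) := by gcongr
      _ ≤ (16 * (m + 1) ^ 2) * 4 ^ (2 * m) := by
          gcongr ?_ * _
          nlinarith
      _ = (m + 1) ^ 2 * 4 ^ (2 * (m + 1)) := by ring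

/-- The induction step reduces to 4(m+1)²(4m+1) ≤ (2m+1)²(4m+5), whose two sides differ by exactly
1. -/
theorem le_centralBinom_sq_mul (m : ℕ) : 4 ^ (2 * m) ≤ m.centralBinom ^ 2 * (4 * m + 1) := by
  induction m with
  | zero => simp
  | succ m ih =>
    have h := Nat.succ_mul_centralBinom_succ m
    have hpos : 0 < (m + 1) ^ 2 * (4 * m + 1) := by positivity
    refine Nat.le_of_mul_le_mul_left ?_ hpos
    calc (m + 1) ^ 2 * (4 * m + 1) * 4 ^ (2 * (m + 1))
        = 16 * (m + 1) ^ 2 * (4 * m + 1) * 4 ^ (2 * m) := by ring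
      _ ≤ 4 * (2 * m + 1) ^ 2 * (4 * m + 5) * 4 ^ (2 * m) := by
          gcongr ?_ * _
          nlinarith
      _ ≤ 4 * (2 * m + 1) ^ 2 * (4 * m + 5) * (m.centralBinom ^ 2 * (4 * m + 1)) := by gcongr
      _ = (2 * (2 * m + 1) * m.centralBinom) ^ 2 * (4 * m + 5) * (4 * m + 1) := by ring
      _ = (m + 1) ^ 2 * (4 * m + 1) * ((m + 1).centralBinom ^ 2 * (4 * (m + 1) + 1)) := by
          rw [← h]; ring

/-- Transfers the central estimates from even rows to odd ones. -/
theorem centralBinom_succ_eq_two_mul (m : ℕ) :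
    (m + 1).centralBinom = 2 * (2 * m + 1).choose m := by
  rw [Nat.centralBinom_eq_two_mul_choose, show 2 * (m + 1) = (2 * m + 1) + 1 by ring,
    Nat.choose_succ_succ, Nat.choose_symm_half, ← two_mul]

theorem choose_half_sq_mul_le (a : ℕ) : a.choose (a / 2) ^ 2 * (a + 1) ≤ 4 ^ a := by
  obtain ⟨m, rfl | rfl⟩ := a.even_or_odd'
  · have h := centralBinom_sq_mul_le m
    rw [Nat.centralBinom_eq_two_mul_choose] at h
    simpa using h
  · have h := centralBinom_sq_mul_le (m + 1)
    rw [centralBinom_succ_eq_two_mul] at h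
    rw [show (2 * m + 1) / 2 = m by omega]
    have e : 4 ^ (2 * (m + 1)) = 4 * 4 ^ (2 * m + 1) := by ring
    rw [e] at h
    nlinarith

theorem le_choose_half_sq_mul (a : ℕ) : 4 ^ a ≤ a.choose (a / 2) ^ 2 * (2 * a + 3) := by
  obtain ⟨m, rfl | rfl⟩ := a.even_or_odd'
  · have h := le_centralBinom_sq_mul m
    rw [Nat.centralBinom_eq_two_mul_choose] at h
    rw [show 2 * m / 2 = m by omega]
    nlinarith
  · have h := le_centralBinom_sq_mul (m + 1)
    rw [centralBinom_succ_eq_two_mul] at h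
    rw [show (2 * m + 1) / 2 = m by omega]
    have e : 4 ^ (2 * (m + 1)) = 4 * 4 ^ (2 * m + 1) := by ring
    rw [e] at h
    nlinarith

theorem choose_le_two_pow_div_sqrt (a b : ℕ) :
    (a.choose b : ℝ) ≤ 2 ^ a / √(a + 1 : ℝ) := by
  have h : (a.choose (a / 2) : ℝ) ^ 2 * (a + 1) ≤ (2 ^ a) ^ 2 := by
    have := choose_half_sq_mul_le a
    rw [← pow_mul, mul_comm a 2, pow_mul]
    norm_num
    exact_mod_cast this
  have h1 : (a.choose b : ℝ) ≤ a.choose (a / 2) := by exact_mod_cast Nat.choose_le_middle b a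
  refine h1.trans ?_
  rw [le_div_iff₀ (by positivity)]
  refine (abs_le_of_sq_le_sq' ?_ (by positivity)).2
  rw [mul_pow, Real.sq_sqrt (by positivity)]
  exact h

theorem two_pow_div_sqrt_le_choose_half (a : ℕ) :
    2 ^ a / √(2 * a + 3 : ℝ) ≤ (a.choose (a / 2) : ℝ) := by
  have h : ((2 : ℝ) ^ a) ^ 2 ≤ (a.choose (a / 2) : ℝ) ^ 2 * (2 * a + 3) := by
    have := le_choose_half_sq_mul a
    rw [← pow_mul, mul_comm a 2, pow_mul]
    norm_num
    exact_mod_cast this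
  rw [div_le_iff₀ (by positivity)]
  refine (abs_le_of_sq_le_sq' ?_ (by positivity)).2
  rw [mul_pow, Real.sq_sqrt (by positivity)]
  exact h

/-- Within t steps of the centre h = ⌊a/2⌋, consecutive coefficients have ratio (a-h-i)/(h+i+1) ≥ 1
- 2t/h. -/
theorem choose_half_mul_pow_le (a t i : ℕ) (hi : i ≤ t) (ht : 2 * t ≤ a / 2) :
    (a.choose (a / 2) : ℝ) * (1 - 2 * t / (a / 2 : ℕ)) ^ i ≤ a.choose (a / 2 + i) := by
  induction i with
  | zero => simp
  | succ i ih =>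
    set h := a / 2 with hh
    have hpos : (0 : ℝ) < h := by
      have : 0 < h := by omega
      exact_mod_cast this
    have htr : (2 * t : ℝ) ≤ h := by exact_mod_cast ht
    have hx : (0 : ℝ) ≤ 1 - 2 * t / h := by
      rw [sub_nonneg, div_le_one hpos]; exact htr
    have hrec : (a.choose (h + i + 1) : ℝ) * (h + i + 1) = a.choose (h + i) * (a - (h + i)) := by
      have := Nat.choose_succ_right_eq a (h + i)
      rw [← Nat.cast_add, ← Nat.cast_sub (by omega)]
      exact_mod_cast this
    have hc : (1 - 2 * t / h : ℝ) * (h + i + 1) ≤ a - (h + i) := by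
      have h2 : (2 * h : ℝ) ≤ a := by
        have : 2 * h ≤ a := by omega
        exact_mod_cast this
      have h3 : (i + 1 : ℝ) ≤ t := by exact_mod_cast hi
      have h4 : (2 * t : ℝ) ≤ 2 * t / h * (h + i + 1) := by
        rw [div_mul_eq_mul_div, le_div_iff₀ hpos]
        gcongr
        have : (0 : ℝ) ≤ i := by positivity
        linarith
      nlinarith
    have hpos2 : (0 : ℝ) < h + i + 1 := by positivity
    rw [← add_assoc]
    refine le_of_mul_le_mul_right ?_ hpos2
    rw [hrec, pow_succ]
    calc (a.choose h : ℝ) * ((1 - 2 * t / h) ^ i * (1 - 2 * t / h)) * (h + i + 1)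
        = (a.choose h * (1 - 2 * t / h) ^ i) * ((1 - 2 * t / h) * (h + i + 1)) := by ring
      _ ≤ a.choose (h + i) * (a - (h + i)) :=
          mul_le_mul (ih (by omega)) hc (by positivity) (by positivity)

theorem exp_le_one_sub {x : ℝ} (h0 : 0 ≤ x) (h1 : x ≤ 1 / 2) : Real.exp (-(2 * x)) ≤ 1 - x := by
  rw [Real.exp_neg, inv_le_comm₀ (Real.exp_pos _) (by linarith)]
  refine le_trans ?_ (Real.add_one_le_exp _)
  rw [inv_le_iff_one_le_mul₀ (by linarith)]
  nlinarith

/-- Binomial coefficients within `L √n` of the centre have the order of the central one. -/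
theorem exists_le_choose {δ : ℝ} (hδ : 0 < δ) (L : ℝ) :
    ∃ c > 0, ∀ᶠ n : ℕ in atTop, ∀ a b : ℕ, δ * n ≤ a → a ≤ n → b ≤ a →
      |2 * (b : ℝ) - a| ≤ L * √n → c * (2 ^ a / √n) ≤ (a.choose b : ℝ) := by
  -- With L ≥ 1 the rounding error in `a / 2` is absorbed into L√n.
  wlog hL : 1 ≤ L generalizing L
  · obtain ⟨c, hc, h⟩ := this 1 le_rfl
    refine ⟨c, hc, ?_⟩
    filter_upwards [h] with n h a b h1 h2 h3 h4
    exact h a b h1 h2 h3 (h4.trans (by gcongr; linarith))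
  -- The √5 comes from 2a + 3 ≤ 5n. The exponent bounds 4t²/h, where t ≤ L√n is the distance from
  -- the centre h ≥ δn/4.
  refine ⟨Real.exp (-(16 * L ^ 2 / δ)) / √5, by positivity, ?_⟩
  have ht : Tendsto (fun n : ℕ => √(n : ℝ)) atTop atTop :=
    Real.tendsto_sqrt_atTop.comp tendsto_natCast_atTop_atTop
  filter_upwards [ht.eventually_ge_atTop (16 * L / δ), eventually_ge_atTop 1,
    tendsto_natCast_atTop_atTop.eventually_ge_atTop (2 / δ)] with n hn1 hn2 hn3 a b hδa han hba hb
  have hn0 : (1 : ℝ) ≤ n := by exact_mod_cast hn2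
  have hs : (1 : ℝ) ≤ √n := by rw [Real.one_le_sqrt]; exact hn0
  have hsq : √(n : ℝ) ^ 2 = n := Real.sq_sqrt (by positivity)
  wlog hab : a ≤ 2 * b generalizing b
  · have := this (a - b) (by omega) (by
      rw [Nat.cast_sub hba, abs_sub_comm]
      convert hb using 2
      ring) (by omega)
    rwa [Nat.choose_symm hba] at this
  obtain ⟨t, rfl⟩ : ∃ t, b = a / 2 + t := ⟨b - a / 2, by omega⟩
  set h := a / 2 with hh
  have ha2 : (a : ℝ) ≤ 2 * h + 1 := by
    have : a ≤ 2 * h + 1 := by omega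
    exact_mod_cast this
  have ha3 : (2 * h : ℝ) ≤ a := by
    have : 2 * h ≤ a := by omega
    exact_mod_cast this
  have hth : (t : ℝ) ≤ L * √n := by
    have := (abs_le.1 hb).2
    push_cast at this
    nlinarith
  have hdn : 2 ≤ δ * n := by
    rw [div_le_iff₀ hδ] at hn3; linarith
  have hhn : δ * n / 4 ≤ h := by linarith
  have hLs : 16 * (L * √n) ≤ δ * n := by
    rw [div_le_iff₀ hδ] at hn1
    nlinarith
  have hhpos : (0 : ℝ) < h := by linarith
  have hx : (2 * t / h : ℝ) ≤ 1 / 2 := by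
    rw [div_le_iff₀ hhpos]; linarith
  have h2t : 2 * t ≤ h := by
    have : (2 * t : ℝ) ≤ h := by linarith
    exact_mod_cast this
  have key := choose_half_mul_pow_le a t t le_rfl h2t
  have hpow : Real.exp (-(16 * L ^ 2 / δ)) ≤ (1 - 2 * t / h : ℝ) ^ t := by
    calc Real.exp (-(16 * L ^ 2 / δ)) ≤ Real.exp (t * -(2 * (2 * t / h))) := by
          rw [Real.exp_le_exp]
          have : (t * (2 * (2 * t / h)) : ℝ) ≤ 16 * L ^ 2 / δ := by
            rw [show (t * (2 * (2 * t / h)) : ℝ) = 4 * t ^ 2 / h by ring,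
              div_le_div_iff₀ hhpos hδ]
            have : (t : ℝ) ^ 2 ≤ L ^ 2 * n := by
              rw [← hsq, ← mul_pow]; gcongr
            have h5 := mul_le_mul_of_nonneg_left this hδ.le
            nlinarith [sq_nonneg L]
          linarith
      _ = Real.exp (-(2 * (2 * t / h))) ^ t := by rw [Real.exp_nat_mul]
      _ ≤ _ := by
          gcongr
          exact exp_le_one_sub (by positivity) hx
  calc Real.exp (-(16 * L ^ 2 / δ)) / √5 * (2 ^ a / √n)
      = 2 ^ a / √(5 * n) * Real.exp (-(16 * L ^ 2 / δ)) := by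
        rw [Real.sqrt_mul (by norm_num)]
        field_simp
    _ ≤ 2 ^ a / √(2 * a + 3) * Real.exp (-(16 * L ^ 2 / δ)) := by
        gcongr
        have : (a : ℝ) ≤ n := by exact_mod_cast han
        linarith
    _ ≤ a.choose h * (1 - 2 * t / h : ℝ) ^ t := by
        gcongr
        exact two_pow_div_sqrt_le_choose_half a
    _ ≤ _ := key

end Binomial

/-! ### Profiles of extensions over the joint classes, and the upper bound for their number. -/

section Extension

variable {ι J : Type*} [Fintype ι] [DecidableEq ι] [Fintype J] [DecidableEq J]

/-- The number of sets that meet each fibre of `cls` in a prescribed number of points. -/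
theorem card_filter_profile {T : Type*} [Fintype T] [DecidableEq T] (cls : ι → T) (b : T → ℕ) :
    (Finset.univ.filter fun B : Finset ι => ∀ S, (B.filter fun i => cls i = S).card = b S).card =
      ∏ S, ((Finset.univ.filter fun i => cls i = S).card).choose (b S) := by
  have h : ∀ S, ((Finset.univ.filter fun i => cls i = S).card).choose (b S) =
      (Finset.powersetCard (b S) (Finset.univ.filter fun i => cls i = S)).card := by
    intro S; rw [Finset.card_powersetCard]
  simp_rw [h]
  rw [← Fintype.card_piFinset]
  refine Finset.card_bij' (fun B _ S => B.filter fun i => cls i = S)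
    (fun f _ => Finset.univ.filter fun i => i ∈ f (cls i)) ?_ ?_ ?_ ?_
  · intro B hB
    simp only [Finset.mem_filter, Finset.mem_univ, true_and] at hB
    simp only [Fintype.mem_piFinset, Finset.mem_powersetCard]
    exact fun S => ⟨Finset.filter_subset_filter _ (Finset.subset_univ _), hB S⟩
  · intro f hf
    simp only [Fintype.mem_piFinset, Finset.mem_powersetCard] at hf
    simp only [Finset.mem_filter, Finset.mem_univ, true_and]
    intro S
    rw [← (hf S).2]
    congr 1
    ext i
    simp only [Finset.mem_filter, Finset.mem_univ, true_and]
    constructor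
    · rintro ⟨h1, rfl⟩; exact h1
    · intro h1
      have := (hf S).1 h1
      simp only [Finset.mem_filter, Finset.mem_univ, true_and] at this
      exact ⟨this ▸ h1, this⟩
  · intro B hB
    ext i; simp
  · intro f hf
    simp only [Fintype.mem_piFinset, Finset.mem_powersetCard] at hf
    ext S i
    simp only [Finset.mem_filter, Finset.mem_univ, true_and]
    constructor
    · rintro ⟨h1, rfl⟩; exact h1
    · intro h1
      have := (hf S).1 h1
      simp only [Finset.mem_filter, Finset.mem_univ, true_and] at this
      exact ⟨this ▸ h1, this⟩

/-- The set of indices of the members of the family that contain a point. -/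
def jointClass (A : J → Finset ι) (i : ι) : Finset J := Finset.univ.filter fun j => i ∈ A j

theorem mem_jointClass {ι J : Type*} [DecidableEq ι] [Fintype J] {A : J → Finset ι} {i : ι} {j : J} : j ∈ jointClass A i ↔ i ∈ A j := by
  simp [jointClass]

/-- The number of points of `ι` with a given joint class. -/
def classSize (A : J → Finset ι) (S : Finset J) : ℕ :=
  (Finset.univ.filter fun i => jointClass A i = S).card

/-- The sets with `2 * m` elements that meet every member of the family in `m` elements. -/
def extensions (m : ℕ) (A : J → Finset ι) : Finset (Finset ι) :=
  Finset.univ.filter fun B => B.card = 2 * m ∧ ∀ j, (A j ∩ B).card = m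

/-- The possible numbers of points of an extension in the joint classes. -/
def profiles (m : ℕ) (a : Finset J → ℕ) : Finset (Finset J → ℕ) :=
  (Fintype.piFinset fun S => Finset.range (a S + 1)).filter fun b =>
    ∑ S, b S = 2 * m ∧ ∀ j, ∑ S, (if j ∈ S then b S else 0) = m

theorem sum_card_filter_jointClass {ι J : Type*} [DecidableEq ι] [Fintype J] [DecidableEq J]
    (A : J → Finset ι) (B : Finset ι) :
    ∑ S, (B.filter fun i => jointClass A i = S).card = B.card :=
  (Finset.card_eq_sum_card_fiberwise fun _ _ => Finset.mem_coe.2 (Finset.mem_univ _)).symm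

theorem sum_ite_card_filter_jointClass {ι J : Type*} [DecidableEq ι] [Fintype J] [DecidableEq J]
    (A : J → Finset ι) (B : Finset ι) (j : J) :
    ∑ S, (if j ∈ S then (B.filter fun i => jointClass A i = S).card else 0) =
      (A j ∩ B).card := by
  rw [← sum_card_filter_jointClass A (A j ∩ B)]
  refine Finset.sum_congr rfl fun S _ => ?_
  split_ifs with h
  · congr 1
    ext i
    simp only [Finset.mem_filter, Finset.mem_inter]
    constructor
    · rintro ⟨h1, rfl⟩; exact ⟨⟨mem_jointClass.1 h, h1⟩, rfl⟩
    · rintro ⟨⟨_, h1⟩, h2⟩; exact ⟨h1, h2⟩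
  · symm
    rw [Finset.card_eq_zero, Finset.filter_eq_empty_iff]
    rintro i hi rfl
    exact h (mem_jointClass.2 (Finset.mem_inter.1 hi).1)

/-- Whether a set is an extension depends only on how many points it takes from each joint class, so
extensions can be grouped by profile. -/
theorem card_extensions (m : ℕ) (A : J → Finset ι) :
    (extensions m A).card =
      ∑ b ∈ profiles m (classSize A), ∏ S, (classSize A S).choose (b S) := by
  have hmaps : ∀ B ∈ extensions m A,
      (fun S => (B.filter fun i => jointClass A i = S).card) ∈ profiles m (classSize A) := by
    intro B hB
    simp only [extensions, Finset.mem_filter, Finset.mem_univ, true_and] at hB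
    simp only [profiles, Finset.mem_filter, Fintype.mem_piFinset, Finset.mem_range,
      Nat.lt_succ_iff]
    refine ⟨fun S => Finset.card_le_card (Finset.filter_subset_filter _ (Finset.subset_univ _)),
      ?_, fun j => ?_⟩
    · rw [sum_card_filter_jointClass, hB.1]
    · rw [sum_ite_card_filter_jointClass, hB.2]
  rw [Finset.card_eq_sum_card_fiberwise hmaps]
  refine Finset.sum_congr rfl fun b hb => ?_
  unfold classSize
  rw [← card_filter_profile]
  congr 1
  ext B
  simp only [Finset.mem_filter, extensions, Finset.mem_univ, true_and]
  simp only [profiles, Finset.mem_filter] at hb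
  constructor
  · rintro ⟨_, rfl⟩; exact fun S => rfl
  · intro h
    have hb' : b = fun S => (B.filter fun i => jointClass A i = S).card := funext fun S => (h S).symm
    refine ⟨⟨?_, fun j => ?_⟩, hb'.symm⟩
    · rw [← sum_card_filter_jointClass A, ← hb.2.1, hb']
    · rw [← sum_ite_card_filter_jointClass, ← hb.2.2 j, hb']

theorem sum_classSize (A : J → Finset ι) : ∑ S, classSize A S = Fintype.card ι :=
  sum_card_filter_jointClass A Finset.univ

theorem sum_ite_classSize (A : J → Finset ι) (j : J) :
    ∑ S, (if j ∈ S then classSize A S else 0) = (A j).card := by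
  have := sum_ite_card_filter_jointClass A Finset.univ j
  rwa [Finset.inter_univ] at this

theorem eq_empty_or_singleton {α : Type*} {S : Finset α} (hS : S.card < 2) :
    S = ∅ ∨ ∃ j, S = {j} := by
  rcases Nat.lt_succ_iff_lt_or_eq.1 hS with h | h
  · exact Or.inl (Finset.card_eq_zero.1 (Nat.lt_one_iff.1 h))
  · exact Or.inr (Finset.card_eq_one.1 h)

/-- The classes with at most one index match the |J| + 1 equations: they carry the dependent
coordinates of a profile, and their number is the exponent of √n. -/
theorem card_small_finsets :
    Fintype.card {S : Finset J // ¬ 2 ≤ S.card} = Fintype.card J + 1 := by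
  rw [Fintype.card_subtype]
  have h : (Finset.univ.filter fun S : Finset J => ¬ 2 ≤ S.card) =
      insert ∅ (Finset.univ.map ⟨fun j : J => ({j} : Finset J), Finset.singleton_injective⟩) := by
    ext S
    simp only [Finset.mem_filter, Finset.mem_univ, true_and, Finset.mem_insert, Finset.mem_map,
      Function.Embedding.coeFn_mk]
    rw [not_le]
    constructor
    · intro hS
      rcases eq_empty_or_singleton hS with h | ⟨j, h⟩
      · exact Or.inl h
      · exact Or.inr ⟨j, h.symm⟩
    · rintro (rfl | ⟨j, rfl⟩) <;> simp
  rw [h, Finset.card_insert_of_notMem, Finset.card_map, Finset.card_univ]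
  simp

theorem sum_finset_eq {M : Type*} [AddCommMonoid M] (f : Finset J → M) :
    ∑ S, f S = f ∅ + ∑ j, f {j} + ∑ S : {S : Finset J // 2 ≤ S.card}, f S := by
  rw [← Fintype.sum_subtype_add_sum_subtype (fun S : Finset J => 2 ≤ S.card) f, add_comm]
  congr 1
  let e : Option J → {S : Finset J // ¬ 2 ≤ S.card} := fun o =>
    o.elim ⟨∅, by simp⟩ fun j => ⟨{j}, by simp⟩
  have he : Function.Bijective e := by
    rw [Fintype.bijective_iff_injective_and_card, card_small_finsets, Fintype.card_option]
    refine ⟨?_, rfl⟩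
    rintro (_ | i) (_ | j) h
    · rfl
    · simp [e, Subtype.ext_iff] at h
    · simp [e, Subtype.ext_iff] at h
    · simpa [e, Subtype.ext_iff] using h
  rw [← he.sum_comp, Fintype.sum_option]
  rfl

/-- A profile is determined by its values on the classes with at least two indices. -/
theorem profiles_ext {m : ℕ} {a b b' : Finset J → ℕ} (hb : b ∈ profiles m a)
    (hb' : b' ∈ profiles m a) (h : ∀ S : Finset J, 2 ≤ S.card → b S = b' S) : b = b' := by
  simp only [profiles, Finset.mem_filter] at hb hb'
  have hs : ∀ j, b {j} = b' {j} := by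
    intro j
    have h1 := hb.2.2 j
    rw [← hb'.2.2 j, sum_finset_eq, sum_finset_eq] at h1
    simp only [Finset.notMem_empty, if_false, Finset.mem_singleton, Finset.sum_ite_eq,
      Finset.mem_univ, if_true, zero_add] at h1
    have h2 : ∑ S : {S : Finset J // 2 ≤ S.card}, (if j ∈ S.1 then b S else 0) =
        ∑ S : {S : Finset J // 2 ≤ S.card}, (if j ∈ S.1 then b' S else 0) :=
      Finset.sum_congr rfl fun S _ => by rw [h S.1 S.2]
    omega
  have he : b ∅ = b' ∅ := by
    have h1 := hb.2.1
    rw [← hb'.2.1, sum_finset_eq, sum_finset_eq] at h1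
    have h2 : ∑ S : {S : Finset J // 2 ≤ S.card}, b S = ∑ S : {S : Finset J // 2 ≤ S.card}, b' S :=
      Finset.sum_congr rfl fun S _ => h S.1 S.2
    have h3 : ∑ j, b {j} = ∑ j, b' {j} := Finset.sum_congr rfl fun j _ => hs j
    omega
  funext S
  rcases Nat.lt_or_ge S.card 2 with hS | hS
  · rcases eq_empty_or_singleton hS with rfl | ⟨j, rfl⟩
    · exact he
    · exact hs j
  · exact h S hS

/-- Each of the |J| + 1 dependent coordinates contributes at most a maximal binomial coefficient,
which saves a factor √t. The remaining coordinates determine the profile, and summing over all their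
values gives at most full powers of 2. -/
theorem card_extensions_le {m : ℕ} {A : J → Finset ι} {t : ℝ} (ht : 0 < t)
    (hA : ∀ S, t ≤ classSize A S) :
    ((extensions m A).card : ℝ) ≤ 2 ^ Fintype.card ι / √t ^ (Fintype.card J + 1) := by
  set a := classSize A with ha
  rw [card_extensions]
  push_cast
  calc ∑ b ∈ profiles m a, ∏ S, ((a S).choose (b S) : ℝ)
      ≤ ∑ b ∈ profiles m a, (∏ S : {S : Finset J // 2 ≤ S.card}, ((a S).choose (b S) : ℝ)) *
          ∏ S : {S : Finset J // ¬ 2 ≤ S.card}, (2 ^ a S / √t) := by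
        refine Finset.sum_le_sum fun b _ => ?_
        rw [← Fintype.prod_subtype_mul_prod_subtype (fun S : Finset J => 2 ≤ S.card)]
        gcongr with S _
        refine (choose_le_two_pow_div_sqrt _ _).trans ?_
        have := hA S.1
        gcongr
        linarith
    _ ≤ (∏ S : {S : Finset J // 2 ≤ S.card}, (2 : ℝ) ^ a S) *
          ∏ S : {S : Finset J // ¬ 2 ≤ S.card}, (2 ^ a S / √t) := by
        rw [← Finset.sum_mul]
        gcongr
        have h2 : ∀ k : ℕ, (2 : ℝ) ^ k = ∑ i ∈ Finset.range (k + 1), (k.choose i : ℝ) := by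
          intro k
          have := Nat.sum_range_choose k
          exact_mod_cast this.symm
        simp_rw [h2]
        rw [Finset.prod_univ_sum]
        -- Restriction to the free coordinates is injective on profiles, so the sum is part of the
        -- expanded product of row sums.
        refine le_trans (le_of_eq ?_) (Finset.sum_le_sum_of_subset_of_nonneg
          (s := (profiles m a).image fun b (S : {S : Finset J // 2 ≤ S.card}) => b S.1) ?_ ?_)
        · rw [Finset.sum_image]
          intro b hb b' hb' hbb
          exact profiles_ext hb hb' fun S hS => congrFun hbb ⟨S, hS⟩
        · intro f hf
          rw [Finset.mem_image] at hf
          obtain ⟨b, hb, rfl⟩ := hf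
          simp only [profiles, Finset.mem_filter, Fintype.mem_piFinset] at hb
          exact Fintype.mem_piFinset.2 fun S => hb.1 S.1
        · intro f _ _
          positivity
    _ = 2 ^ Fintype.card ι / √t ^ (Fintype.card J + 1) := by
        rw [Finset.prod_div_distrib, ← mul_div_assoc,
          Fintype.prod_subtype_mul_prod_subtype (fun S : Finset J => 2 ≤ S.card)
            (fun S => (2 : ℝ) ^ a S), Finset.prod_pow_eq_pow_sum, ha, sum_classSize,
          Finset.prod_const, Finset.card_univ, card_small_finsets]

/-- The value at a singleton that the values on the larger classes force. -/
def singletonValue (m : ℕ) (u : Finset J → ℤ) (j : J) : ℤ :=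
  m - ∑ S : {S : Finset J // 2 ≤ S.card}, if j ∈ S.1 then u S else 0

/-- The integral profile with prescribed values on the classes with at least two indices. -/
def extendProfile (m : ℕ) (u : Finset J → ℤ) (S : Finset J) : ℤ :=
  if 2 ≤ S.card then u S else
    if S = ∅ then 2 * m - (∑ j, singletonValue m u j + ∑ S : {S : Finset J // 2 ≤ S.card}, u S)
    else ∑ j ∈ S, singletonValue m u j

theorem extendProfile_of_two_le (m : ℕ) (u : Finset J → ℤ) {S : Finset J} (hS : 2 ≤ S.card) :
    extendProfile m u S = u S := if_pos hS

theorem extendProfile_singleton (m : ℕ) (u : Finset J → ℤ) (j : J) :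
    extendProfile m u {j} = singletonValue m u j := by
  simp [extendProfile]

theorem sum_extendProfile (m : ℕ) (u : Finset J → ℤ) : ∑ S, extendProfile m u S = 2 * m := by
  rw [sum_finset_eq]
  simp_rw [extendProfile_singleton]
  have : ∑ S : {S : Finset J // 2 ≤ S.card}, extendProfile m u S =
      ∑ S : {S : Finset J // 2 ≤ S.card}, u S :=
    Finset.sum_congr rfl fun S _ => extendProfile_of_two_le m u S.2
  rw [this]
  simp [extendProfile]
  ring

theorem sum_ite_extendProfile (m : ℕ) (u : Finset J → ℤ) (j : J) :
    ∑ S, (if j ∈ S then extendProfile m u S else 0) = m := by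
  rw [sum_finset_eq]
  simp_rw [extendProfile_singleton]
  have : ∑ S : {S : Finset J // 2 ≤ S.card}, (if j ∈ S.1 then extendProfile m u S else 0) =
      ∑ S : {S : Finset J // 2 ≤ S.card}, (if j ∈ S.1 then u S else 0) :=
    Finset.sum_congr rfl fun S _ => by rw [extendProfile_of_two_le m u S.2]
  rw [this]
  simp [singletonValue]

/-- Half the class sizes solve the profile equations exactly, so the deviations from them solve the
homogeneous system. The dependent deviations are then integer combinations of the free ones. -/
theorem abs_extendProfile_sub_le {m : ℕ} {a : Finset J → ℕ} (ha : ∑ S, a S = 4 * m)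
    (haj : ∀ j, ∑ S, (if j ∈ S then a S else 0) = 2 * m) {u : Finset J → ℤ} {D : ℝ} (hD : 0 ≤ D)
    (hu : ∀ S : Finset J, 2 ≤ S.card → |2 * (u S : ℝ) - a S| ≤ D) (S : Finset J) :
    |2 * (extendProfile m u S : ℝ) - a S| ≤
      (Fintype.card J + 1) * Fintype.card (Finset J) * D := by
  set d : Finset J → ℝ := fun S => 2 * (extendProfile m u S : ℝ) - a S with hd
  have hfree : ∀ S : Finset J, 2 ≤ S.card → |d S| ≤ D := by
    intro S hS
    simp only [hd]
    rw [extendProfile_of_two_le m u hS]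
    exact hu S hS
  have hM : (Fintype.card {S : Finset J // 2 ≤ S.card} : ℝ) ≤ Fintype.card (Finset J) := by
    exact_mod_cast Fintype.card_subtype_le _
  have hM1 : (1 : ℝ) ≤ Fintype.card (Finset J) := by
    exact_mod_cast Fintype.card_pos
  have hsum : ∑ S, d S = 0 := by
    have h1 : ((∑ S, extendProfile m u S : ℤ) : ℝ) = 2 * m := by
      rw [sum_extendProfile]; push_cast; ring
    have h2 : ((∑ S, a S : ℕ) : ℝ) = 4 * m := by rw [ha]; push_cast; ring
    push_cast at h1 h2
    simp only [hd]
    rw [Finset.sum_sub_distrib, ← Finset.mul_sum, h1, h2]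
    ring
  have hsumj : ∀ j, ∑ S, (if j ∈ S then d S else 0) = 0 := by
    intro j
    have h1 : ((∑ S, (if j ∈ S then extendProfile m u S else 0) : ℤ) : ℝ) = m := by
      rw [sum_ite_extendProfile]; push_cast; ring
    have h2 : ((∑ S, (if j ∈ S then a S else 0) : ℕ) : ℝ) = 2 * m := by
      rw [haj]; push_cast; ring
    push_cast at h1 h2
    have : ∀ S, (if j ∈ S then d S else 0) =
        2 * (if j ∈ S then (extendProfile m u S : ℝ) else 0) - if j ∈ S then (a S : ℝ) else 0 := by
      intro S; split_ifs <;> simp [hd]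
    simp_rw [this]
    rw [Finset.sum_sub_distrib, ← Finset.mul_sum, h1, h2]
    ring
  have hsingle : ∀ j, |d {j}| ≤ Fintype.card (Finset J) * D := by
    intro j
    have h := hsumj j
    rw [sum_finset_eq] at h
    simp only [Finset.notMem_empty, if_false, Finset.mem_singleton, Finset.sum_ite_eq,
      Finset.mem_univ, if_true, zero_add] at h
    rw [eq_neg_of_add_eq_zero_left h, abs_neg]
    calc _ ≤ ∑ S : {S : Finset J // 2 ≤ S.card}, |if j ∈ S.1 then d S else 0| :=
          Finset.abs_sum_le_sum_abs _ _
      _ ≤ ∑ S : {S : Finset J // 2 ≤ S.card}, D := by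
          refine Finset.sum_le_sum fun S _ => ?_
          split_ifs
          · exact hfree S.1 S.2
          · simpa using hD
      _ ≤ _ := by
          rw [Finset.sum_const, Finset.card_univ, nsmul_eq_mul]
          gcongr
  have hempty : |d ∅| ≤ (Fintype.card J + 1) * Fintype.card (Finset J) * D := by
    have h := hsum
    rw [sum_finset_eq, add_assoc] at h
    rw [eq_neg_of_add_eq_zero_left h, abs_neg]
    refine (abs_add_le _ _).trans ?_
    have h1 : |∑ j, d {j}| ≤ Fintype.card J * (Fintype.card (Finset J) * D) := by
      refine (Finset.abs_sum_le_sum_abs _ _).trans ?_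
      refine (Finset.sum_le_sum fun j _ => hsingle j).trans ?_
      rw [Finset.sum_const, Finset.card_univ, nsmul_eq_mul]
    have h2 : |∑ S : {S : Finset J // 2 ≤ S.card}, d S| ≤ Fintype.card (Finset J) * D := by
      refine (Finset.abs_sum_le_sum_abs _ _).trans ?_
      refine (Finset.sum_le_sum fun S _ => hfree S.1 S.2).trans ?_
      rw [Finset.sum_const, Finset.card_univ, nsmul_eq_mul]
      gcongr
    linarith
  have hMD : D ≤ Fintype.card (Finset J) * D := by nlinarith
  have hJ : (0 : ℝ) ≤ Fintype.card J * (Fintype.card (Finset J) * D) := by positivity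
  change |d S| ≤ _
  rcases Nat.lt_or_ge S.card 2 with hS | hS
  · rcases eq_empty_or_singleton hS with rfl | ⟨j, rfl⟩
    · exact hempty
    · exact (hsingle j).trans (by linarith)
  · exact (hfree S hS).trans (by linarith)

end Extension

/-! ### The lower bound for the number of extensions. -/

section ExtensionLower

variable {J : Type*} [Fintype J] [DecidableEq J]

/-- The values `⌊a S / 2⌋ + v S` on the classes with at least two indices. -/
def shiftedHalf (a : Finset J → ℕ) (v : {S : Finset J // 2 ≤ S.card} → ℕ) (S : Finset J) : ℤ :=
  if h : 2 ≤ S.card then ((a S / 2 + v ⟨S, h⟩ : ℕ) : ℤ) else 0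

/-- Shifting each free coordinate by 0, ..., ⌊√n⌋ from half its class size keeps every coordinate
within O(√n) of the centre. Each such profile contributes a product of near-central coefficients,
and there is a factor of at least √n for every free coordinate. -/
theorem exists_le_card_extensions (J : Type*) [Fintype J] [DecidableEq J] {δ : ℝ} (hδ : 0 < δ) :
    ∃ c > 0, ∀ᶠ n : ℕ in atTop, ∀ m : ℕ, n = 4 * m → ∀ A : J → Finset (Fin n),
      (∀ j, (A j).card = 2 * m) → (∀ S, δ * n ≤ classSize A S) →
      c * (2 ^ n / √n ^ (Fintype.card J + 1)) ≤ ((extensions m A).card : ℝ) := by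
  -- The 3 covers a shift of at most √n, counted twice, and the rounding of `a S / 2`. The other
  -- factors come from `abs_extendProfile_sub_le`.
  set L : ℝ := (Fintype.card J + 1) * Fintype.card (Finset J) * 3 with hL
  have hLpos : 0 < L := by
    have : (0 : ℝ) < Fintype.card (Finset J) := by exact_mod_cast Fintype.card_pos
    positivity
  obtain ⟨c₀, hc₀, hchoose⟩ := exists_le_choose hδ L
  refine ⟨c₀ ^ Fintype.card (Finset J), by positivity, ?_⟩
  have ht : Tendsto (fun n : ℕ => √(n : ℝ)) atTop atTop :=
    Real.tendsto_sqrt_atTop.comp tendsto_natCast_atTop_atTop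
  filter_upwards [hchoose, ht.eventually_ge_atTop (L / δ), eventually_ge_atTop 1]
    with n hch hn1 hn2 m hm A hA hcls
  have hs : (1 : ℝ) ≤ √n := by
    rw [Real.one_le_sqrt]; exact_mod_cast hn2
  have hsq : √(n : ℝ) * √n = n := Real.mul_self_sqrt (by positivity)
  set a := classSize A with ha
  have hasum : ∑ S, a S = 4 * m := by rw [ha, sum_classSize, Fintype.card_fin, hm]
  have hasumj : ∀ j, ∑ S, (if j ∈ S then a S else 0) = 2 * m := fun j => by
    rw [ha, sum_ite_classSize, hA]
  have han : ∀ S, a S ≤ n := by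
    intro S
    rw [hm, ← hasum]
    exact Finset.single_le_sum (f := a) (fun _ _ => Nat.zero_le _) (Finset.mem_univ S)
  -- Deviations are thus at most the class sizes, so the integral profiles lie between 0 and `a S`.
  have hLn : L * √n ≤ δ * n := by
    rw [div_le_iff₀ hδ] at hn1
    calc L * √n ≤ √n * δ * √n := by gcongr
      _ = δ * (√n * √n) := by ring
      _ = δ * n := by rw [hsq]
  set K := ⌊√(n : ℝ)⌋₊ with hK
  have hKn : (K : ℝ) ≤ √n := Nat.floor_le (by positivity)
  let box : Finset ({S : Finset J // 2 ≤ S.card} → ℕ) :=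
    Fintype.piFinset fun _ => Finset.range (K + 1)
  let φ : ({S : Finset J // 2 ≤ S.card} → ℕ) → Finset J → ℕ := fun v S =>
    (extendProfile m (shiftedHalf a v) S).toNat
  have hdev : ∀ v ∈ box, ∀ S, |2 * (extendProfile m (shiftedHalf a v) S : ℝ) - a S| ≤ L * √n := by
    intro v hv S
    rw [hL, mul_assoc _ (3 : ℝ)]
    refine abs_extendProfile_sub_le hasum hasumj (by positivity) (fun S hS => ?_) S
    rw [shiftedHalf, dif_pos hS]
    have h1 : (v ⟨S, hS⟩ : ℝ) ≤ √n := by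
      have := Fintype.mem_piFinset.1 hv ⟨S, hS⟩
      rw [Finset.mem_range, Nat.lt_succ_iff] at this
      exact (Nat.cast_le.2 this).trans hKn
    have h2 : (a S : ℝ) ≤ 2 * (a S / 2 : ℕ) + 1 := by
      have : a S ≤ 2 * (a S / 2) + 1 := by omega
      exact_mod_cast this
    have h3 : (2 * (a S / 2 : ℕ) : ℝ) ≤ a S := by
      have : 2 * (a S / 2) ≤ a S := by omega
      exact_mod_cast this
    have h4 : (0 : ℝ) ≤ v ⟨S, hS⟩ := by positivity
    rw [Int.cast_natCast, Nat.cast_add, abs_le]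
    constructor <;> linarith
  have hnonneg : ∀ v ∈ box, ∀ S, 0 ≤ extendProfile m (shiftedHalf a v) S := by
    intro v hv S
    have h1 := (abs_le.1 (hdev v hv S)).1
    have h2 : (0 : ℝ) ≤ extendProfile m (shiftedHalf a v) S := by linarith [hcls S]
    exact_mod_cast h2
  have hle : ∀ v ∈ box, ∀ S, extendProfile m (shiftedHalf a v) S ≤ a S := by
    intro v hv S
    have h1 := (abs_le.1 (hdev v hv S)).2
    have h2 : (extendProfile m (shiftedHalf a v) S : ℝ) ≤ a S := by linarith [hcls S]
    exact_mod_cast h2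
  have hφ : ∀ v ∈ box, ∀ S, ((φ v S : ℕ) : ℤ) = extendProfile m (shiftedHalf a v) S :=
    fun v hv S => Int.toNat_of_nonneg (hnonneg v hv S)
  have hmem : ∀ v ∈ box, φ v ∈ profiles m a := by
    intro v hv
    simp only [profiles, Finset.mem_filter, Fintype.mem_piFinset, Finset.mem_range,
      Nat.lt_succ_iff]
    refine ⟨fun S => ?_, ?_, fun j => ?_⟩
    · have := hle v hv S
      rw [← hφ v hv S] at this
      exact_mod_cast this
    · have := sum_extendProfile m (shiftedHalf a v)
      simp_rw [← hφ v hv] at this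
      exact_mod_cast this
    · have := sum_ite_extendProfile m (shiftedHalf a v) j
      simp_rw [← hφ v hv] at this
      exact_mod_cast this
  have hinj : Set.InjOn φ box := by
    intro v hv v' hv' h
    funext ⟨S, hS⟩
    have h1 : ((φ v S : ℕ) : ℤ) = φ v' S := by rw [h]
    rw [hφ v hv, hφ v' hv', extendProfile_of_two_le _ _ hS, extendProfile_of_two_le _ _ hS,
      shiftedHalf, shiftedHalf, dif_pos hS, dif_pos hS] at h1
    have h2 := Nat.cast_injective h1
    omega
  have hterm : ∀ v ∈ box, c₀ ^ Fintype.card (Finset J) *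
      (2 ^ n / √n ^ Fintype.card (Finset J)) ≤ ∏ S, ((a S).choose (φ v S) : ℝ) := by
    intro v hv
    calc c₀ ^ Fintype.card (Finset J) * (2 ^ n / √n ^ Fintype.card (Finset J))
        = ∏ S : Finset J, c₀ * (2 ^ a S / √n) := by
          rw [Finset.prod_mul_distrib, Finset.prod_div_distrib, Finset.prod_pow_eq_pow_sum,
            hasum, ← hm, Finset.prod_const, Finset.prod_const, Finset.card_univ]
      _ ≤ _ := by
          refine Finset.prod_le_prod (fun _ _ => by positivity) fun S _ => ?_
          refine hch (a S) (φ v S) (hcls S) (han S) ?_ ?_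
          · have := hle v hv S
            rw [← hφ v hv S] at this
            exact_mod_cast this
          · have h1 := hdev v hv S
            rw [← hφ v hv S] at h1
            exact_mod_cast h1
  have hcard : Fintype.card {S : Finset J // 2 ≤ S.card} + (Fintype.card J + 1) =
      Fintype.card (Finset J) := by
    rw [← card_small_finsets, Fintype.card_subtype_compl]
    have := Fintype.card_subtype_le fun S : Finset J => 2 ≤ S.card
    omega
  rw [card_extensions]
  push_cast
  calc c₀ ^ Fintype.card (Finset J) * (2 ^ n / √n ^ (Fintype.card J + 1))
      = √n ^ Fintype.card {S : Finset J // 2 ≤ S.card} *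
          (c₀ ^ Fintype.card (Finset J) * (2 ^ n / √n ^ Fintype.card (Finset J))) := by
        rw [← hcard, pow_add (√(n : ℝ))]
        field_simp
        ring
    _ ≤ box.card * (c₀ ^ Fintype.card (Finset J) * (2 ^ n / √n ^ Fintype.card (Finset J))) := by
        gcongr
        rw [Fintype.card_piFinset, Finset.prod_const, Finset.card_univ, Finset.card_range]
        push_cast
        gcongr
        exact (Nat.lt_floor_add_one _).le
    _ ≤ ∑ v ∈ box, ∏ S, ((a S).choose (φ v S) : ℝ) := by
        rw [← nsmul_eq_mul]
        exact Finset.card_nsmul_le_sum _ _ _ hterm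
    _ = ∑ b ∈ box.image φ, ∏ S, ((a S).choose (b S) : ℝ) := by
        rw [Finset.sum_image hinj]
    _ ≤ ∑ b ∈ profiles m a, ∏ S, ((a S).choose (b S) : ℝ) :=
        Finset.sum_le_sum_of_subset_of_nonneg (Finset.image_subset_iff.2 hmem)
          fun _ _ _ => by positivity

end ExtensionLower

/-! ### Families with an unusually small joint class are exponentially rare. -/

section BadTuples

/-- Few families of subsets of a set have a joint class that is much smaller than average. -/
theorem card_small_class_le {J : Type*} [Fintype J] [DecidableEq J] (n : ℕ) (S : Finset J)
    {δ : ℝ} :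
    (((Finset.univ : Finset (J → Finset (Fin n))).filter
      fun A => ¬ δ * n ≤ classSize A S).card : ℝ) ≤
      (2 ^ δ * (Fintype.card (Finset J) - 1 / 2)) ^ n := by
  classical
  -- Exponential moment: a family is the same as an independent choice of a joint class for each
  -- point, so the sum factorises. Markov's inequality then gives the bound.
  have hw : ∑ A : J → Finset (Fin n), (1 / 2 : ℝ) ^ classSize A S =
      (Fintype.card (Finset J) - 1 / 2 : ℝ) ^ n := by
    have e : ∑ c : Fin n → Finset J, ∏ i, (if c i = S then (1 / 2 : ℝ) else 1) =
        (Fintype.card (Finset J) - 1 / 2 : ℝ) ^ n := by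
      have := Finset.prod_univ_sum (fun _ : Fin n => (Finset.univ : Finset (Finset J)))
        fun _ T => if T = S then (1 / 2 : ℝ) else 1
      rw [Fintype.piFinset_univ] at this
      rw [← this, Finset.prod_const, Finset.card_univ, Fintype.card_fin]
      congr 1
      have h1 : ∀ T : Finset J, (if T = S then (1 / 2 : ℝ) else 1) = 1 - if T = S then 1 / 2 else 0 := by
        intro T; split_ifs <;> norm_num
      simp_rw [h1]
      rw [Finset.sum_sub_distrib]
      simp
    rw [← e]
    refine Finset.sum_bij' (fun A _ => jointClass A)
      (fun c _ j => Finset.univ.filter fun i => j ∈ c i) (by simp) (by simp) ?_ ?_ ?_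
    · intro A _
      ext j i
      simp [mem_jointClass]
    · intro c _
      ext i j
      simp [mem_jointClass]
    · intro A _
      rw [Finset.prod_ite, Finset.prod_const, Finset.prod_const_one, mul_one]
      rfl
  have h2 : (((Finset.univ : Finset (J → Finset (Fin n))).filter
      fun A => ¬ δ * n ≤ classSize A S).card : ℝ) * (1 / 2 : ℝ) ^ (δ * n) ≤
      (Fintype.card (Finset J) - 1 / 2 : ℝ) ^ n := by
    rw [← hw, ← nsmul_eq_mul]
    refine le_trans (Finset.card_nsmul_le_sum _ (fun A => (1 / 2 : ℝ) ^ classSize A S) _ ?_)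
      (Finset.sum_le_sum_of_subset_of_nonneg (Finset.filter_subset _ _)
        fun _ _ _ => by positivity)
    intro A hA
    rw [Finset.mem_filter, not_le] at hA
    rw [← Real.rpow_natCast]
    exact Real.rpow_le_rpow_of_exponent_ge (by norm_num) (by norm_num) hA.2.le
  have h3 : ((1 / 2 : ℝ) ^ (δ * n)) = ((2 ^ δ) ^ n)⁻¹ := by
    rw [Real.rpow_mul (by norm_num), Real.rpow_natCast, one_div, Real.inv_rpow (by norm_num),
      inv_pow]
  rw [h3, ← div_eq_mul_inv, div_le_iff₀ (by positivity)] at h2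
  rw [mul_pow, mul_comm (((2 : ℝ) ^ δ) ^ n)]
  exact h2

/-- For a suitable `δ`, all but an exponentially small proportion of the families of subsets of
`Fin n` have all joint classes of size at least `δ n`. -/
theorem exists_card_small_class_le (J : Type*) [Fintype J] [DecidableEq J] :
    ∃ δ : ℝ, 0 < δ ∧ ∃ r : ℝ, 0 < r ∧ r < 1 ∧ ∀ n : ℕ,
      (((Finset.univ : Finset (J → Finset (Fin n))).filter
        fun A => ¬ ∀ S, δ * n ≤ classSize A S).card : ℝ) ≤
        Fintype.card (Finset J) * (r ^ n * (2 ^ n) ^ Fintype.card J) := by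
  classical
  set M : ℝ := (Fintype.card (Finset J) : ℝ) with hM
  have hM1 : 1 ≤ M := by
    rw [hM]; exact_mod_cast Fintype.card_pos
  have hMJ : M = 2 ^ Fintype.card J := by rw [hM, Fintype.card_finset]; push_cast; rfl
  -- Possible by continuity, since the left side tends to M - 1/2 as δ → 0.
  obtain ⟨δ, hδ0, hδ⟩ : ∃ δ : ℝ, 0 < δ ∧ 2 ^ δ * (M - 1 / 2) < M := by
    have hc : Tendsto (fun δ : ℝ => (2 : ℝ) ^ δ * (M - 1 / 2)) (𝓝[>] 0) (𝓝 (2 ^ (0 : ℝ) * (M - 1 / 2))) := by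
      refine Tendsto.mul_const _ ?_
      exact ((Real.continuous_const_rpow (by norm_num)).tendsto 0).mono_left nhdsWithin_le_nhds
    have := (hc.eventually_lt_const (u := M) (by simp)).and self_mem_nhdsWithin
    obtain ⟨δ, h1, h2⟩ := this.exists
    exact ⟨δ, h2, h1⟩
  refine ⟨δ, hδ0, 2 ^ δ * (M - 1 / 2) / M, ?_, ?_, fun n => ?_⟩
  · have : 0 < M - 1 / 2 := by linarith
    positivity
  · rw [div_lt_one (by linarith)]; exact hδ
  · have h1 : ((Finset.univ : Finset (J → Finset (Fin n))).filter
        fun A => ¬ ∀ S, δ * n ≤ classSize A S) ⊆ (Finset.univ : Finset (Finset J)).biUnion fun S =>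
          (Finset.univ : Finset (J → Finset (Fin n))).filter
            fun A => ¬ δ * n ≤ classSize A S := by
      intro A hA
      simpa using hA
    have h2 := (Finset.card_le_card h1).trans Finset.card_biUnion_le
    have h3 : (((Finset.univ : Finset (J → Finset (Fin n))).filter
        fun A => ¬ ∀ S, δ * n ≤ classSize A S).card : ℝ) ≤ ∑ S : Finset J,
          ((((Finset.univ : Finset (J → Finset (Fin n))).filter
            fun A => ¬ δ * n ≤ classSize A S).card : ℕ) : ℝ) := by exact_mod_cast h2
    refine h3.trans ((Finset.sum_le_sum fun S _ => card_small_class_le n S).trans ?_)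
    rw [Finset.sum_const, Finset.card_univ, nsmul_eq_mul, ← hM]
    refine le_of_eq ?_
    congr 1
    rw [← pow_mul, mul_comm n, pow_mul, ← hMJ, div_pow, div_mul_cancel₀]
    positivity

end BadTuples

/-! ### Counting families of sets with prescribed intersections, by induction on the vertices. -/

section TupleCounts

open Classical in
/-- The families of `2 * m`-subsets of `Fin n` in which adjacent indices carry sets that meet in
`m` points. -/
noncomputable def homTuples {U : Type*} [Fintype U] (n m : ℕ) (K : SimpleGraph U) :
    Finset (U → Finset (Fin n)) :=
  Finset.univ.filter fun A => (∀ i, (A i).card = 2 * m) ∧ ∀ i j, K.Adj i j → (A i ∩ A j).card = m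

theorem mem_homTuples {U : Type*} [Fintype U] {n m : ℕ} {K : SimpleGraph U}
    {A : U → Finset (Fin n)} : A ∈ homTuples n m K ↔
      (∀ i, (A i).card = 2 * m) ∧ ∀ i j, K.Adj i j → (A i ∩ A j).card = m := by
  simp [homTuples]

open Classical in
theorem card_homTuples_succ {k : ℕ} (n m : ℕ) (K : SimpleGraph (Fin (k + 1))) :
    (homTuples n m K).card = ∑ A ∈ homTuples n m (K.comap Fin.succ),
      (extensions m fun j : {i : Fin k // K.Adj 0 i.succ} => A j).card := by
  rw [← Finset.card_sigma]
  refine Finset.card_bij' (fun A _ => ⟨Fin.tail A, A 0⟩) (fun p _ => Fin.cons p.2 p.1)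
    ?_ ?_ ?_ ?_
  · intro A hA
    rw [mem_homTuples] at hA
    simp only [Finset.mem_sigma, mem_homTuples, extensions, Finset.mem_filter, Finset.mem_univ,
      true_and, SimpleGraph.comap_adj]
    refine ⟨⟨fun i => hA.1 _, fun i j h => hA.2 _ _ h⟩, hA.1 0, fun j => ?_⟩
    exact hA.2 _ _ j.2.symm
  · rintro ⟨A, B⟩ h
    simp only [Finset.mem_sigma, mem_homTuples, extensions, Finset.mem_filter, Finset.mem_univ,
      true_and, SimpleGraph.comap_adj] at h
    rw [mem_homTuples]
    obtain ⟨⟨h1, h2⟩, h3, h4⟩ := h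
    refine ⟨fun i => ?_, fun i j => ?_⟩
    · refine Fin.cases ?_ (fun i => ?_) i
      · simpa using h3
      · simpa using h1 i
    · refine Fin.cases ?_ (fun i => ?_) i <;> refine Fin.cases ?_ (fun j => ?_) j
      · intro h; exact (K.irrefl h).elim
      · intro h
        have := h4 ⟨j, h⟩
        rw [Finset.inter_comm] at this
        simpa using this
      · intro h
        have := h4 ⟨i, h.symm⟩
        simpa using this
      · intro h
        simpa using h2 i j h
  · intro A _
    exact Fin.cons_self_tail A
  · rintro ⟨A, B⟩ _
    simp

theorem ncard_edgeSet_succ {k : ℕ} (K : SimpleGraph (Fin (k + 1))) [DecidableRel K.Adj] :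
    K.edgeSet.ncard = (K.comap Fin.succ).edgeSet.ncard +
      Fintype.card {i : Fin k // K.Adj 0 i.succ} := by
  have h : K.edgeSet = Sym2.map Fin.succ '' (K.comap Fin.succ).edgeSet ∪
      (fun i : Fin k => s(0, i.succ)) '' {i | K.Adj 0 i.succ} := by
    ext e
    induction e with
    | _ a b =>
    simp only [SimpleGraph.mem_edgeSet, Set.mem_union, Set.mem_image, Set.mem_ofPred_eq]
    constructor
    · intro h
      revert h
      refine Fin.cases ?_ (fun a => ?_) a <;> refine Fin.cases ?_ (fun b => ?_) b
      · intro h; exact (K.irrefl h).elim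
      · intro h; exact Or.inr ⟨b, h, rfl⟩
      · intro h; exact Or.inr ⟨a, h.symm, Sym2.eq_swap⟩
      · intro h; exact Or.inl ⟨s(a, b), h, rfl⟩
    · rintro (⟨e, he, h⟩ | ⟨i, hi, h⟩)
      · induction e with
        | _ c d =>
        rw [← SimpleGraph.mem_edgeSet, ← h]
        exact he
      · rw [← SimpleGraph.mem_edgeSet, ← h]
        exact hi
  rw [h, Set.ncard_union_eq, Set.ncard_image_of_injective _ (Sym2.map.injective (Fin.succ_injective k)),
    Set.ncard_image_of_injective, ← Nat.card_eq_fintype_card, ← _root_.Nat.card_coe_set_eq]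
  · rfl
  · intro i j hij
    simp only [Sym2.eq_iff, true_and, Fin.succ_inj] at hij
    rcases hij with h | h
    · exact h
    · exact absurd h.1.symm (Fin.succ_ne_zero j)
  · rw [Set.disjoint_left]
    rintro _ ⟨e, he, rfl⟩ ⟨i, hi, h⟩
    induction e with
    | _ c d =>
    simp only [Sym2.map_mk, Sym2.eq_iff] at h
    rcases h with h | h
    · exact (Fin.succ_ne_zero _ h.1.symm)
    · exact (Fin.succ_ne_zero _ h.1.symm)

/-- Forgetting some sets merges joint classes. Largeness for the whole family therefore passes to
the neighbours of the vertex being added, the only sets that constrain it. -/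
theorem classSize_le_subfamily {J : Type*} [Fintype J] [DecidableEq J] {n : ℕ}
    (A : J → Finset (Fin n)) (p : J → Prop) [DecidablePred p] (S : Finset {j // p j}) :
    classSize A (S.map (Function.Embedding.subtype p)) ≤
      classSize (fun j : {j // p j} => A j) S := by
  refine Finset.card_le_card fun i hi => ?_
  rw [Finset.mem_filter] at hi ⊢
  refine ⟨Finset.mem_univ _, ?_⟩
  ext j
  rw [mem_jointClass, ← mem_jointClass (A := A), hi.2]
  simpa using fun _ => j.2

theorem eventually_mul_pow_le {r : ℝ} (hr0 : 0 < r) (hr1 : r < 1) (C : ℝ) (s : ℕ) {η : ℝ}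
    (hη : 0 < η) : ∀ᶠ n : ℕ in atTop, C * r ^ n ≤ η / √n ^ s := by
  have h := (tendsto_pow_const_mul_const_pow_of_abs_lt_one s (abs_lt.2 ⟨by linarith, hr1⟩)).const_mul |C|
  rw [mul_zero] at h
  filter_upwards [h.eventually_le_const hη, eventually_ge_atTop 1] with n hn hn1
  have hn1' : (1 : ℝ) ≤ n := by exact_mod_cast hn1
  have hs : √(n : ℝ) ≤ n := by
    rw [Real.sqrt_le_left (by positivity)]
    nlinarith
  rw [le_div_iff₀ (by positivity)]
  refine le_trans ?_ hn
  calc C * r ^ n * √n ^ s ≤ |C| * r ^ n * (n : ℝ) ^ s := by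
        gcongr
        exact le_abs_self C
    _ = _ := by ring

/-- Adding a vertex with d earlier neighbours multiplies the count by O(2^n/√n^(d+1)) over families
with large classes. Over the others the trivial factor 2^n is enough. -/
theorem exists_card_homTuples_le {k : ℕ} (K : SimpleGraph (Fin k)) :
    ∃ C > 0, ∀ᶠ n : ℕ in atTop, ∀ m, n = 4 * m →
      ((homTuples n m K).card : ℝ) ≤ C * ((2 ^ n) ^ k / √n ^ (k + K.edgeSet.ncard)) := by
  classical
  induction k with
  | zero =>
    refine ⟨1, one_pos, Eventually.of_forall fun n m _ => ?_⟩
    have hK : K.edgeSet = ∅ := by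
      ext e
      induction e with
      | _ a b => exact a.elim0
    rw [hK]
    simp only [Set.ncard_empty, pow_zero, add_zero, div_one, mul_one]
    exact_mod_cast (Finset.card_le_univ _).trans (by simp)
  | succ k ih =>
    obtain ⟨C, hC, hup⟩ := ih (K.comap Fin.succ)
    obtain ⟨δ, hδ, r, hr0, hr1, hbad⟩ := exists_card_small_class_le (Fin k)
    set e' := (K.comap Fin.succ).edgeSet.ncard
    set d := Fintype.card {i : Fin k // K.Adj 0 i.succ} with hd
    have he : K.edgeSet.ncard = e' + d := ncard_edgeSet_succ K
    have hδ' : 0 < √δ := Real.sqrt_pos.2 hδ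
    -- The first term accounts for the families with large classes, the 1 for all others.
    refine ⟨C / √δ ^ (d + 1) + 1, by positivity, ?_⟩
    filter_upwards [hup, eventually_ge_atTop 1,
      eventually_mul_pow_le hr0 hr1 (Fintype.card (Finset (Fin k))) (k + 1 + (e' + d)) one_pos]
      with n hn hn1 hrn m hm
    have hn0 : (0 : ℝ) < n := by exact_mod_cast hn1
    have hsn : 0 < √(n : ℝ) := Real.sqrt_pos.2 hn0
    rw [card_homTuples_succ, he]
    push_cast
    rw [← Finset.sum_filter_add_sum_filter_not _ fun A => ∀ S, δ * n ≤ classSize A S]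
    have h1 : ∑ A ∈ (homTuples n m (K.comap Fin.succ)).filter
        (fun A => ∀ S, δ * n ≤ classSize A S),
        ((extensions m fun j : {i : Fin k // K.Adj 0 i.succ} => A j).card : ℝ) ≤
        C / √δ ^ (d + 1) * ((2 ^ n) ^ (k + 1) / √n ^ (k + 1 + (e' + d))) := by
      have : ∀ A ∈ (homTuples n m (K.comap Fin.succ)).filter
          (fun A => ∀ S, δ * n ≤ classSize A S),
          ((extensions m fun j : {i : Fin k // K.Adj 0 i.succ} => A j).card : ℝ) ≤
          2 ^ n / (√δ * √n) ^ (d + 1) := by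
        intro A hA
        rw [Finset.mem_filter] at hA
        refine (card_extensions_le (t := δ * n) (by positivity) fun S => ?_).trans_eq ?_
        · refine (hA.2 _).trans (Nat.cast_le.2 (classSize_le_subfamily A _ S))
        · rw [Fintype.card_fin, Real.sqrt_mul hδ.le]
      refine (Finset.sum_le_card_nsmul _ _ _ this).trans ?_
      rw [nsmul_eq_mul]
      calc _ ≤ (C * ((2 ^ n) ^ k / √n ^ (k + e'))) * (2 ^ n / (√δ * √n) ^ (d + 1)) := by
            gcongr
            refine le_trans ?_ (hn m hm)
            exact_mod_cast Finset.card_filter_le _ _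
        _ = _ := by
            rw [mul_pow, show k + 1 + (e' + d) = (k + e') + (d + 1) by ring, pow_add (√(n : ℝ)),
              pow_succ ((2 : ℝ) ^ n)]
            field_simp
            ring
    have h2 : ∑ A ∈ (homTuples n m (K.comap Fin.succ)).filter
        (fun A => ¬ ∀ S, δ * n ≤ classSize A S),
        ((extensions m fun j : {i : Fin k // K.Adj 0 i.succ} => A j).card : ℝ) ≤
        1 * ((2 ^ n) ^ (k + 1) / √n ^ (k + 1 + (e' + d))) := by
      have : ∀ A ∈ (homTuples n m (K.comap Fin.succ)).filter
          (fun A => ¬ ∀ S, δ * n ≤ classSize A S),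
          ((extensions m fun j : {i : Fin k // K.Adj 0 i.succ} => A j).card : ℝ) ≤ 2 ^ n := by
        intro A _
        have := Finset.card_le_univ (extensions m fun j : {i : Fin k // K.Adj 0 i.succ} => A j)
        rw [Fintype.card_finset, Fintype.card_fin] at this
        exact_mod_cast this
      refine (Finset.sum_le_card_nsmul _ _ _ this).trans ?_
      rw [nsmul_eq_mul]
      have h3 : (((homTuples n m (K.comap Fin.succ)).filter
          (fun A => ¬ ∀ S, δ * n ≤ classSize A S)).card : ℝ) ≤ _ :=
        le_trans (Nat.cast_le.2 (Finset.card_le_card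
          (Finset.filter_subset_filter _ (Finset.subset_univ _)))) (hbad n)
      rw [Fintype.card_fin, ← mul_assoc] at h3
      calc _ ≤ (1 / √n ^ (k + 1 + (e' + d)) * (2 ^ n) ^ k) * 2 ^ n := by
            gcongr
            exact h3.trans (by gcongr)
        _ = _ := by rw [pow_succ ((2 : ℝ) ^ n)]; ring
    rw [add_mul]
    exact add_le_add h1 h2

/-- A positive proportion of the families in `homTuples` have joint classes of at least `δ n`
points. -/
theorem exists_le_card_homTuples_filter {k : ℕ} (K : SimpleGraph (Fin k)) {c : ℝ} (hc : 0 < c)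
    (h : ∀ᶠ n : ℕ in atTop, ∀ m, n = 4 * m →
      c * ((2 ^ n) ^ k / √n ^ (k + K.edgeSet.ncard)) ≤ ((homTuples n m K).card : ℝ)) :
    ∃ δ : ℝ, 0 < δ ∧ ∀ᶠ n : ℕ in atTop, ∀ m, n = 4 * m →
      c / 2 * ((2 ^ n) ^ k / √n ^ (k + K.edgeSet.ncard)) ≤
        (((homTuples n m K).filter fun A => ∀ S, δ * n ≤ classSize A S).card : ℝ) := by
  classical
  obtain ⟨δ, hδ, r, hr0, hr1, hbad⟩ := exists_card_small_class_le (Fin k)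
  refine ⟨δ, hδ, ?_⟩
  filter_upwards [h, eventually_mul_pow_le hr0 hr1 (Fintype.card (Finset (Fin k)))
    (k + K.edgeSet.ncard) (half_pos hc)] with n hn hrn m hm
  have h1 := Finset.card_filter_add_card_filter_not (s := homTuples n m K)
    (fun A => ∀ S, δ * n ≤ classSize A S)
  have h2 : (((homTuples n m K).filter fun A => ∀ S, δ * n ≤ classSize A S).card : ℝ) +
      (((homTuples n m K).filter fun A => ¬ ∀ S, δ * n ≤ classSize A S).card : ℝ) =
        (homTuples n m K).card := by exact_mod_cast h1
  have h3 : (((homTuples n m K).filter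
      (fun A => ¬ ∀ S, δ * n ≤ classSize A S)).card : ℝ) ≤ _ :=
    le_trans (Nat.cast_le.2 (Finset.card_le_card
      (Finset.filter_subset_filter _ (Finset.subset_univ _)))) (hbad n)
  rw [Fintype.card_fin, ← mul_assoc] at h3
  have h4 : (Fintype.card (Finset (Fin k)) * r ^ n) * (2 ^ n) ^ k ≤
      c / 2 * ((2 ^ n) ^ k / √n ^ (k + K.edgeSet.ncard)) := by
    calc _ ≤ (c / 2 / √n ^ (k + K.edgeSet.ncard)) * (2 ^ n) ^ k := by gcongr
      _ = _ := by ring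
  have h5 := hn m hm
  linarith

/-- Only families with large classes are extended; they are still a positive proportion of the main
term, at the cost of halving the constant. -/
theorem exists_le_card_homTuples {k : ℕ} (K : SimpleGraph (Fin k)) :
    ∃ c > 0, ∀ᶠ n : ℕ in atTop, ∀ m, n = 4 * m →
      c * ((2 ^ n) ^ k / √n ^ (k + K.edgeSet.ncard)) ≤ ((homTuples n m K).card : ℝ) := by
  classical
  induction k with
  | zero =>
    refine ⟨1, one_pos, Eventually.of_forall fun n m _ => ?_⟩
    have hK : K.edgeSet = ∅ := by
      ext e
      induction e with
      | _ a b => exact a.elim0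
    rw [hK]
    simp only [Set.ncard_empty, pow_zero, add_zero, div_one, mul_one]
    have : (fun i : Fin 0 => i.elim0) ∈ homTuples n m K :=
      mem_homTuples.2 ⟨fun i => i.elim0, fun i => i.elim0⟩
    exact_mod_cast Finset.card_pos.2 ⟨_, this⟩
  | succ k ih =>
    obtain ⟨c, hc, hlow⟩ := ih (K.comap Fin.succ)
    obtain ⟨δ, hδ, hgood⟩ := exists_le_card_homTuples_filter _ hc hlow
    obtain ⟨c', hc', hext⟩ := exists_le_card_extensions {i : Fin k // K.Adj 0 i.succ} hδ
    set e' := (K.comap Fin.succ).edgeSet.ncard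
    set d := Fintype.card {i : Fin k // K.Adj 0 i.succ} with hd
    have he : K.edgeSet.ncard = e' + d := ncard_edgeSet_succ K
    refine ⟨c / 2 * c', by positivity, ?_⟩
    filter_upwards [hgood, hext] with n hn hx m hm
    rw [card_homTuples_succ, he]
    push_cast
    have : ∀ A ∈ (homTuples n m (K.comap Fin.succ)).filter
        (fun A => ∀ S, δ * n ≤ classSize A S), c' * (2 ^ n / √n ^ (d + 1)) ≤
          ((extensions m fun j : {i : Fin k // K.Adj 0 i.succ} => A j).card : ℝ) := by
      intro A hA
      rw [Finset.mem_filter] at hA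
      refine hx m hm _ (fun j => (mem_homTuples.1 hA.1).1 j) fun S => ?_
      exact (hA.2 _).trans (Nat.cast_le.2 (classSize_le_subfamily A _ S))
    calc _ = (c / 2 * ((2 ^ n) ^ k / √n ^ (k + e'))) * (c' * (2 ^ n / √n ^ (d + 1))) := by
          rw [show k + 1 + (e' + d) = (k + e') + (d + 1) by ring, pow_add (√(n : ℝ)),
            pow_succ ((2 : ℝ) ^ n), ← div_mul_div_comm]
          ring
      _ ≤ _ := mul_le_mul_of_nonneg_right (hn m hm) (by positivity)
      _ ≤ _ := by
          rw [← nsmul_eq_mul]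
          exact Finset.card_nsmul_le_sum _ _ _ this
      _ ≤ _ := Finset.sum_le_sum_of_subset_of_nonneg (Finset.filter_subset _ _)
          fun _ _ _ => by positivity

end TupleCounts

/-! ### Homomorphisms and injective homomorphisms as finite sets of functions. -/

section Homs

variable {U V : Type*} [Fintype U] [Fintype V]

open Classical in
/-- The homomorphisms from `K` to `G`, as functions. -/
noncomputable def homs (K : SimpleGraph U) (G : SimpleGraph V) : Finset (U → V) :=
  Finset.univ.filter fun x => ∀ i j, K.Adj i j → G.Adj (x i) (x j)

open Classical in
/-- The injective homomorphisms from `K` to `G`, as functions. -/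
noncomputable def injHoms (K : SimpleGraph U) (G : SimpleGraph V) : Finset (U → V) :=
  (homs K G).filter Function.Injective

theorem mem_homs {K : SimpleGraph U} {G : SimpleGraph V} {x : U → V} :
    x ∈ homs K G ↔ ∀ i j, K.Adj i j → G.Adj (x i) (x j) := by
  simp [homs]

theorem mem_injHoms {K : SimpleGraph U} {G : SimpleGraph V} {x : U → V} :
    x ∈ injHoms K G ↔ (∀ i j, K.Adj i j → G.Adj (x i) (x j)) ∧ Function.Injective x := by
  simp [injHoms, mem_homs]

theorem card_injHoms_le (K : SimpleGraph U) (G : SimpleGraph V) :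
    (injHoms K G).card ≤ (homs K G).card :=
  Finset.card_le_card fun _ hx => mem_homs.2 (mem_injHoms.1 hx).1

end Homs

/-! ### Vertices as subsets of the coordinates. -/

section Vertices

/-- The set of coordinates of a vertex that are equal to `1`. -/
def supp {n r : ℕ} (x : Vertex n r) : Finset (Fin n) := Finset.univ.filter fun i => x.1 i = 1

theorem supp_injective {n r : ℕ} : Function.Injective (supp : Vertex n r → Finset (Fin n)) := by
  intro x y h
  ext i
  have := Finset.ext_iff.1 h i
  simp only [supp, Finset.mem_filter, Finset.mem_univ, true_and] at this
  have hx := (x.1 i).isLt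
  have hy := (y.1 i).isLt
  rw [Fin.ext_iff, Fin.ext_iff] at this
  simp only [Fin.val_one] at this
  omega

theorem fin_two_val_eq (a : Fin 2) : (a : ℕ) = if a = 1 then 1 else 0 := by
  fin_cases a <;> rfl

theorem card_supp {n r : ℕ} (x : Vertex n r) : (supp x).card = r := by
  refine Eq.trans ?_ x.2
  rw [supp, Finset.card_filter]
  exact Finset.sum_congr rfl fun i _ => (fin_two_val_eq _).symm

theorem card_supp_inter {n r : ℕ} (x y : Vertex n r) :
    (supp x ∩ supp y).card = ∑ i, (x.1 i : ℕ) * (y.1 i : ℕ) := by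
  rw [supp, supp, ← Finset.filter_and, Finset.card_filter]
  refine Finset.sum_congr rfl fun i _ => ?_
  rw [fin_two_val_eq (x.1 i), fin_two_val_eq (y.1 i)]
  split_ifs <;> simp_all

theorem exists_supp_eq {n r : ℕ} (B : Finset (Fin n)) (hB : B.card = r) :
    ∃ x : Vertex n r, supp x = B := by
  refine ⟨⟨fun i => if i ∈ B then 1 else 0, ?_⟩, ?_⟩
  · rw [← hB, Finset.card_eq_sum_ones, ← Finset.sum_filter_add_sum_filter_not _ (· ∈ B)]
    have h1 : ∑ i ∈ Finset.univ.filter (· ∈ B), (((if i ∈ B then 1 else 0 : Fin 2) : Fin 2) : ℕ) =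
        ∑ i ∈ B, 1 := by
      rw [Finset.filter_mem_eq_inter, Finset.univ_inter]
      exact Finset.sum_congr rfl fun i hi => by simp [hi]
    rw [h1]
    simp only [Nat.add_eq_left]
    refine Finset.sum_eq_zero fun i hi => ?_
    simp only [Finset.mem_filter] at hi
    simp [hi.2]
  · ext i
    simp [supp]

theorem ncard_edgeSet_comap_equiv {U U' : Type*} (e : U ≃ U') (K : SimpleGraph U') :
    (K.comap e).edgeSet.ncard = K.edgeSet.ncard := by
  have h := (SimpleGraph.Iso.comap e K).mapEdgeSet
  rw [← Nat.card_coe_set_eq, ← Nat.card_coe_set_eq]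
  exact Nat.card_congr h

end Vertices

/-! ### Translation from n to N, and the order of the homomorphism counts. -/

section Asymptotics

theorem numVertices_le_two_pow (n : ℕ) : numVertices n ≤ 2 ^ n :=
  Nat.choose_le_two_pow _ _

theorem numVertices_le_div_sqrt {n : ℕ} (hn : 1 ≤ n) : (numVertices n : ℝ) ≤ 2 ^ n / √n := by
  have hn' : (0 : ℝ) < n := by exact_mod_cast hn
  have : 0 < √(n : ℝ) := Real.sqrt_pos.2 hn'
  refine (choose_le_two_pow_div_sqrt _ _).trans ?_
  gcongr
  linarith

theorem two_pow_div_sqrt_le_numVertices {n : ℕ} (hn : 1 ≤ n) :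
    2 ^ n / √n ≤ √5 * (numVertices n : ℝ) := by
  have hn' : (1 : ℝ) ≤ n := by exact_mod_cast hn
  have hpos : 0 < √(n : ℝ) := Real.sqrt_pos.2 (by linarith)
  have h := two_pow_div_sqrt_le_choose_half n
  have h2 : (2 : ℝ) ^ n / √(5 * n) ≤ 2 ^ n / √(2 * n + 3) := by
    gcongr
    linarith
  rw [Real.sqrt_mul (by norm_num)] at h2
  calc (2 : ℝ) ^ n / √n = √5 * (2 ^ n / (√5 * √n)) := by field_simp
    _ ≤ √5 * (numVertices n : ℝ) := by
        gcongr
        exact h2.trans h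

/-- A crude bound, but sufficient for ln N to be at least a constant times n. -/
theorem two_pow_le_numVertices_sq {n : ℕ} (hn : 4 ≤ n) : 2 ^ n ≤ numVertices n ^ 2 := by
  have h := le_choose_half_sq_mul n
  have h2 : 2 * n + 3 ≤ 2 ^ n := by
    induction n, hn using Nat.le_induction with
    | base => norm_num
    | succ n hn ih =>
      have := ih (le_choose_half_sq_mul n)
      rw [pow_succ]
      omega
  have h3 : 2 ^ n * 2 ^ n ≤ numVertices n ^ 2 * 2 ^ n := by
    calc 2 ^ n * 2 ^ n = 4 ^ n := by rw [← mul_pow]; norm_num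
      _ ≤ _ := h
      _ ≤ _ := by
        unfold numVertices
        gcongr
  exact Nat.le_of_mul_le_mul_right h3 (by positivity)

theorem log_numVertices_le (n : ℕ) : Real.log (numVertices n) ≤ n := by
  have hpos : 0 < numVertices n := Nat.choose_pos (Nat.div_le_self _ _)
  have h : (numVertices n : ℝ) ≤ 2 ^ n := by exact_mod_cast numVertices_le_two_pow n
  calc Real.log (numVertices n) ≤ Real.log (2 ^ n) :=
        Real.log_le_log (by exact_mod_cast hpos) h
    _ = n * Real.log 2 := by rw [Real.log_pow]
    _ ≤ n * 1 := by
        gcongr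
        linarith [Real.log_two_lt_d9]
    _ = n := mul_one _

theorem sqrt_le_two_mul_sqrt_log_numVertices {n : ℕ} (hn : 4 ≤ n) :
    √n ≤ 2 * √(Real.log (numVertices n)) := by
  have h : (2 : ℝ) ^ n ≤ (numVertices n : ℝ) ^ 2 := by exact_mod_cast two_pow_le_numVertices_sq hn
  have h2 := Real.log_le_log (by positivity) h
  rw [Real.log_pow, Real.log_pow] at h2
  push_cast at h2
  have h3 : (n : ℝ) / 4 ≤ Real.log (numVertices n) := by
    have := Real.log_two_gt_d9
    have hn0 : (0 : ℝ) ≤ n := by positivity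
    nlinarith
  rw [show (2 : ℝ) = √4 by rw [show (4 : ℝ) = 2 ^ 2 by norm_num, Real.sqrt_sq (by norm_num)],
    ← Real.sqrt_mul (by norm_num)]
  apply Real.sqrt_le_sqrt
  linarith

theorem eventually_toInfinity {P : ℕ → Prop} (h : ∀ᶠ n in atTop, 4 ∣ n → P n) :
    ∀ᶠ n in toInfinity, P n := by
  rw [toInfinity, eventually_inf_principal]
  exact h

theorem toInfinity_le_atTop : toInfinity ≤ atTop := inf_le_left

/-- The order of the number of homomorphisms from a graph with `v` vertices and `e` edges. -/
noncomputable def homOrder (v e n : ℕ) : ℝ :=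
  (numVertices n : ℝ) ^ v / √(Real.log (numVertices n)) ^ e

theorem exists_card_homs_le {U : Type*} [Fintype U] (K : SimpleGraph U) :
    ∃ C > 0, ∀ᶠ n in toInfinity, ((homs K (graph n)).card : ℝ) ≤
      C * homOrder (Fintype.card U) K.edgeSet.ncard n := by
  classical
  let e := Fintype.equivFin U
  set k := Fintype.card U
  obtain ⟨C, hC, h⟩ := exists_card_homTuples_le (K.comap e.symm)
  rw [ncard_edgeSet_comap_equiv] at h
  refine ⟨C * √5 ^ k, by positivity, eventually_toInfinity ?_⟩
  filter_upwards [h, eventually_ge_atTop 4] with n hn hn4 hdvd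
  obtain ⟨m, hm⟩ := hdvd
  have hsub : (homs K (graph n)).card ≤ (homTuples n m (K.comap e.symm)).card := by
    refine Finset.card_le_card_of_injOn (fun x i => supp (x (e.symm i))) ?_ ?_
    · intro x hx
      rw [Finset.mem_coe, mem_homs] at hx
      rw [Finset.mem_coe, mem_homTuples]
      refine ⟨fun i => ?_, fun i j hij => ?_⟩
      · rw [card_supp]; omega
      · rw [card_supp_inter, (hx _ _ hij).2]; omega
    · intro x _ y _ hxy
      funext u
      have := congrFun hxy (e u)
      simp only [Equiv.symm_apply_apply] at this
      exact supp_injective this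
  have hs : 0 < √(n : ℝ) := Real.sqrt_pos.2 (by exact_mod_cast (by omega : 0 < n))
  have hl : 0 < √(Real.log (numVertices n)) := by
    have := sqrt_le_two_mul_sqrt_log_numVertices hn4
    linarith
  calc ((homs K (graph n)).card : ℝ) ≤ (homTuples n m (K.comap e.symm)).card := by
        exact_mod_cast hsub
    _ ≤ C * ((2 ^ n) ^ k / √n ^ (k + K.edgeSet.ncard)) := hn m hm
    _ = C * ((2 ^ n / √n) ^ k / √n ^ K.edgeSet.ncard) := by
        rw [pow_add, div_pow, div_div]
    _ ≤ C * ((√5 * numVertices n) ^ k / √(Real.log (numVertices n)) ^ K.edgeSet.ncard) := by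
        gcongr
        · exact two_pow_div_sqrt_le_numVertices (by omega)
        · exact log_numVertices_le n
    _ = _ := by
        rw [homOrder, mul_pow]; ring

theorem exists_le_card_injHoms {U : Type*} [Fintype U] (K : SimpleGraph U) :
    ∃ c > 0, ∀ᶠ n in toInfinity,
      c * homOrder (Fintype.card U) K.edgeSet.ncard n ≤ ((injHoms K (graph n)).card : ℝ) := by
  classical
  let e := Fintype.equivFin U
  set k := Fintype.card U
  obtain ⟨c, hc, h⟩ := exists_le_card_homTuples (K.comap e.symm)
  obtain ⟨δ, hδ, h⟩ := exists_le_card_homTuples_filter _ hc h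
  rw [ncard_edgeSet_comap_equiv] at h
  -- The first 2 is lost in discarding small classes, the powers of 2 in √n ≤ 2√(ln N).
  refine ⟨c / 2 / 2 ^ K.edgeSet.ncard, by positivity, eventually_toInfinity ?_⟩
  filter_upwards [h, eventually_ge_atTop 4] with n hn hn4 hdvd
  obtain ⟨m, hm⟩ := hdvd
  have hn0 : (0 : ℝ) < n := by exact_mod_cast (by omega : 0 < n)
  have hsub : ((homTuples n m (K.comap e.symm)).filter
      fun A => ∀ S, δ * n ≤ classSize A S).card ≤ (injHoms K (graph n)).card := by
    refine Finset.card_le_card_of_surjOn (fun x i => supp (x (e.symm i))) ?_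
    intro A hA
    rw [Finset.mem_coe, Finset.mem_filter, mem_homTuples] at hA
    obtain ⟨⟨h1, h2⟩, h3⟩ := hA
    have hx : ∀ i, ∃ x : Vertex n (n / 2), supp x = A i := fun i =>
      exists_supp_eq _ ((h1 i).trans (by omega))
    choose x hx using hx
    -- Large classes force injectivity: the class of {i} is nonempty, and its points lie in `A i`
    -- and in no other member.
    have hAinj : Function.Injective A := by
      intro i j hij
      by_contra hne
      have hpos : 0 < classSize A {i} := by
        have h4 : (0 : ℝ) < classSize A {i} := lt_of_lt_of_le (by positivity) (h3 {i})
        exact_mod_cast h4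
      obtain ⟨t, ht⟩ := Finset.card_pos.1 hpos
      rw [Finset.mem_filter] at ht
      have hti : t ∈ A i := mem_jointClass.1 (by rw [ht.2]; simp)
      rw [hij, ← mem_jointClass, ht.2, Finset.mem_singleton] at hti
      exact hne hti.symm
    have hxinj : Function.Injective x := by
      intro i j hij
      apply hAinj
      rw [← hx, ← hx, hij]
    refine ⟨fun u => x (e u), ?_, ?_⟩
    · rw [Finset.mem_coe, mem_injHoms]
      refine ⟨fun i j hij => ⟨?_, ?_⟩, hxinj.comp e.injective⟩
      · exact fun h => hij.ne (e.injective (hxinj h))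
      · rw [← card_supp_inter, hx, hx, h2]
        · omega
        · simpa using hij
    · funext i
      simp [hx]
  have hs : 0 < √(n : ℝ) := Real.sqrt_pos.2 hn0
  have hl2 := sqrt_le_two_mul_sqrt_log_numVertices hn4
  have hl : 0 < √(Real.log (numVertices n)) := by linarith
  calc c / 2 / 2 ^ K.edgeSet.ncard * homOrder k K.edgeSet.ncard n
      = c / 2 * ((numVertices n : ℝ) ^ k /
          (2 * √(Real.log (numVertices n))) ^ K.edgeSet.ncard) := by
        rw [homOrder, mul_pow]
        field_simp
    _ ≤ c / 2 * ((2 ^ n / √n) ^ k / √n ^ K.edgeSet.ncard) := by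
        gcongr
        exact numVertices_le_div_sqrt (by omega)
    _ = c / 2 * ((2 ^ n) ^ k / √n ^ (k + K.edgeSet.ncard)) := by
        rw [pow_add, div_pow, div_div]
    _ ≤ _ := hn m hm
    _ ≤ _ := by exact_mod_cast hsub

end Asymptotics

/-! ### The random spanning subgraph: edge sets, Markov and Chebyshev. -/

section Probability

variable {V : Type*} [Fintype V] {G : SimpleGraph V} {p : ℝ}

theorem mem_spanningSubgraphs {H : SimpleGraph V} : H ∈ spanningSubgraphs G ↔ H ≤ G := by
  simp [spanningSubgraphs]

theorem weight_nonneg {V : Type*} {G : SimpleGraph V} (hp : p ∈ Set.Icc (0 : ℝ) 1)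
    (H : SimpleGraph V) : 0 ≤ weight G p H := by
  have h0 := hp.1
  have h1 : 0 ≤ 1 - p := by linarith [hp.2]
  unfold weight
  positivity

/-- The probability that a given set of edges is kept. -/
theorem sum_weight_superset (G : SimpleGraph V) (p : ℝ) (T : Finset (Sym2 V))
    (hT : (T : Set (Sym2 V)) ⊆ G.edgeSet)
    [DecidablePred fun H : SimpleGraph V => (T : Set (Sym2 V)) ⊆ H.edgeSet] :
    ∑ H ∈ (spanningSubgraphs G).filter (fun H => (T : Set (Sym2 V)) ⊆ H.edgeSet), weight G p H =
      p ^ T.card := by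
  classical
  -- The edges outside T remain free, and their weights sum to (p + (1 - p)) to the number of such
  -- edges.
  have h := Finset.sum_pow_mul_eq_add_pow p (1 - p) (G.edgeFinset \ T)
  rw [add_sub_cancel, one_pow] at h
  have hTG : T ⊆ G.edgeFinset := by
    intro e he
    simpa using hT he
  rw [← mul_one (p ^ T.card), ← h, Finset.mul_sum]
  refine Finset.sum_bij' (fun H _ => H.edgeFinset \ T)
    (fun t _ => SimpleGraph.fromEdgeSet ((t ∪ T : Finset (Sym2 V)) : Set (Sym2 V))) ?_ ?_ ?_ ?_ ?_
  · intro H hH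
    rw [Finset.mem_filter, mem_spanningSubgraphs] at hH
    rw [Finset.mem_powerset]
    exact Finset.sdiff_subset_sdiff (SimpleGraph.edgeFinset_subset_edgeFinset.2 hH.1) subset_rfl
  · intro t ht
    rw [Finset.mem_powerset] at ht
    have hsub : ∀ e ∈ t ∪ T, e ∈ G.edgeSet := by
      intro e he
      rw [Finset.mem_union] at he
      rcases he with he | he
      · simpa using (Finset.mem_sdiff.1 (ht he)).1
      · exact hT he
    rw [Finset.mem_filter, mem_spanningSubgraphs]
    refine ⟨fun a b hab => ?_, fun e he => ?_⟩
    · rw [SimpleGraph.fromEdgeSet_adj] at hab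
      exact hsub _ (Finset.mem_coe.1 hab.1)
    · rw [SimpleGraph.edgeSet_fromEdgeSet]
      refine ⟨Finset.mem_coe.2 (Finset.mem_union_right _ he), ?_⟩
      exact G.not_isDiag_of_mem_edgeSet (hT he)
  · intro H hH
    rw [Finset.mem_filter] at hH
    have : H.edgeFinset \ T ∪ T = H.edgeFinset := by
      refine Finset.sdiff_union_of_subset fun e he => ?_
      simpa using hH.2 he
    simp only [this]
    simp
  · intro t ht
    rw [Finset.mem_powerset] at ht
    ext e
    simp only [Finset.mem_sdiff, SimpleGraph.mem_edgeFinset, SimpleGraph.edgeSet_fromEdgeSet,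
      Set.mem_sdiff, Finset.mem_coe, Finset.mem_union]
    constructor
    · rintro ⟨⟨h1 | h1, _⟩, h2⟩
      · exact h1
      · exact absurd h1 h2
    · intro he
      have h1 := Finset.mem_sdiff.1 (ht he)
      refine ⟨⟨Or.inl he, ?_⟩, h1.2⟩
      exact G.not_isDiag_of_mem_edgeSet (by simpa using h1.1)
  · intro H hH
    rw [Finset.mem_filter, mem_spanningSubgraphs] at hH
    have hTH : T ⊆ H.edgeFinset := fun e he => by simpa using hH.2 he
    have hHG := SimpleGraph.edgeFinset_subset_edgeFinset.2 hH.1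
    have h1 := Finset.card_sdiff_add_card_eq_card hTH
    have h2 := Finset.card_sdiff_add_card_eq_card hTG
    simp only [weight]
    rw [← SimpleGraph.coe_edgeFinset H, ← SimpleGraph.coe_edgeFinset G,
      Set.ncard_coe_finset, Set.ncard_coe_finset, ← h1, pow_add, ← h2]
    rw [show (G.edgeFinset \ T).card + T.card - ((H.edgeFinset \ T).card + T.card) =
      (G.edgeFinset \ T).card - (H.edgeFinset \ T).card by omega]
    ring

theorem prob_add_prob_not (G : SimpleGraph V) (p : ℝ) (A : SimpleGraph V → Prop) :
    prob G p A + prob G p (fun H => ¬ A H) = 1 := by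
  classical
  rw [← sum_weight G p, prob, prob]
  convert Finset.sum_filter_add_sum_filter_not (spanningSubgraphs G) A (weight G p)

theorem prob_nonneg (hp : p ∈ Set.Icc (0 : ℝ) 1) (A : SimpleGraph V → Prop) : 0 ≤ prob G p A :=
  Finset.sum_nonneg fun H _ => weight_nonneg hp H

theorem prob_le_one (hp : p ∈ Set.Icc (0 : ℝ) 1) (A : SimpleGraph V → Prop) : prob G p A ≤ 1 := by
  linarith [prob_add_prob_not G p A, prob_nonneg (G := G) hp fun H => ¬ A H]

theorem prob_mono (hp : p ∈ Set.Icc (0 : ℝ) 1) {A B : SimpleGraph V → Prop}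
    (h : ∀ H ≤ G, A H → B H) : prob G p A ≤ prob G p B := by
  classical
  refine Finset.sum_le_sum_of_subset_of_nonneg ?_ fun H _ _ => weight_nonneg hp H
  intro H hH
  rw [Finset.mem_filter] at hH ⊢
  exact ⟨hH.1, h H (mem_spanningSubgraphs.1 hH.1) hH.2⟩

/-- Markov's inequality. -/
theorem prob_le_expect (hp : p ∈ Set.Icc (0 : ℝ) 1) {A : SimpleGraph V → Prop}
    {X : SimpleGraph V → ℝ} (hX : ∀ H, 0 ≤ X H) (h : ∀ H ≤ G, A H → 1 ≤ X H) :
    prob G p A ≤ expect G p X := by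
  classical
  refine le_trans (Finset.sum_le_sum fun H hH => ?_) (Finset.sum_le_sum_of_subset_of_nonneg
    (Finset.filter_subset A _) fun H _ _ => mul_nonneg (weight_nonneg hp H) (hX H))
  rw [Finset.mem_filter, mem_spanningSubgraphs] at hH
  exact le_mul_of_one_le_right (weight_nonneg hp H) (h H hH.1 hH.2)

/-- Chebyshev's inequality. -/
theorem prob_not_lt_le (hp : p ∈ Set.Icc (0 : ℝ) 1) {X : SimpleGraph V → ℝ} {ε : ℝ} (hε : 0 < ε)
    (hX : expect G p X ≠ 0) :
    prob G p (fun H => ¬ |X H / expect G p X - 1| < ε) ≤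
      (expect G p (fun H => X H ^ 2) / expect G p X ^ 2 - 1) / ε ^ 2 := by
  set μ := expect G p X with hμ
  have h := prob_le_expect (G := G) hp (A := fun H => ¬ |X H / μ - 1| < ε)
    (X := fun H => (X H / μ - 1) ^ 2 / ε ^ 2) (fun H => by positivity) (fun H _ hH => by
      rw [one_le_div (by positivity), ← sq_abs (X H / μ - 1)]
      exact pow_le_pow_left₀ hε.le (not_lt.1 hH) 2)
  refine h.trans_eq ?_
  have : ∀ H, weight G p H * ((X H / μ - 1) ^ 2 / ε ^ 2) =
      (1 / μ ^ 2 * (weight G p H * X H ^ 2) - 2 / μ * (weight G p H * X H) + weight G p H) /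
        ε ^ 2 := by
    intro H; field_simp; ring
  unfold expect
  simp_rw [this]
  rw [← Finset.sum_div, Finset.sum_add_distrib, Finset.sum_sub_distrib, sum_weight,
    ← Finset.mul_sum, ← Finset.mul_sum]
  change (1 / μ ^ 2 * _ - 2 / μ * μ + 1) / ε ^ 2 = _
  congr 1
  field_simp
  ring

end Probability

/-! ### First and second moments of the number of embeddings. -/

section Moments

variable {W V : Type*} [Fintype W] [Fintype V] {F : SimpleGraph W} {G : SimpleGraph V} {p : ℝ}

open Classical in
/-- The images of the edges of `F` under a map of the vertices. -/
noncomputable def edgeImage (F : SimpleGraph W) (x : W → V) : Finset (Sym2 V) :=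
  F.edgeFinset.image (Sym2.map x)

theorem coe_edgeImage {V : Type*} (F : SimpleGraph W) (x : W → V) :
    (edgeImage F x : Set (Sym2 V)) = Sym2.map x '' F.edgeSet := by
  simp [edgeImage]

theorem edgeImage_subset_iff {V : Type*} {G : SimpleGraph V} {x : W → V} :
    (edgeImage F x : Set (Sym2 V)) ⊆ G.edgeSet ↔ ∀ i j, F.Adj i j → G.Adj (x i) (x j) := by
  rw [coe_edgeImage, Set.image_subset_iff]
  constructor
  · intro h i j hij
    exact h (show s(i, j) ∈ F.edgeSet from hij)
  · intro h e he
    induction e with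
    | _ i j => exact h i j he

theorem card_edgeImage {V : Type*} {x : W → V} (hx : Function.Injective x) :
    (edgeImage F x).card = F.edgeSet.ncard := by
  rw [← Set.ncard_coe_finset, coe_edgeImage, Set.ncard_image_of_injective _ (Sym2.map.injective hx)]

theorem mem_injHoms_iff_edgeImage {H : SimpleGraph V} (hH : H ≤ G) {x : W → V} :
    x ∈ injHoms F H ↔ x ∈ injHoms F G ∧ (edgeImage F x : Set (Sym2 V)) ⊆ H.edgeSet := by
  rw [mem_injHoms, mem_injHoms, edgeImage_subset_iff]
  exact ⟨fun h => ⟨⟨fun i j hij => hH (h.1 i j hij), h.2⟩, h.1⟩, fun h => ⟨h.2, h.1.2⟩⟩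

theorem edgeImage_subset_of_mem {x : W → V} (hx : x ∈ injHoms F G) :
    (edgeImage F x : Set (Sym2 V)) ⊆ G.edgeSet :=
  edgeImage_subset_iff.2 (mem_injHoms.1 hx).1

theorem expect_card_injHoms (F : SimpleGraph W) (G : SimpleGraph V) (p : ℝ) :
    expect G p (fun H => ((injHoms F H).card : ℝ)) =
      (injHoms F G).card * p ^ F.edgeSet.ncard := by
  classical
  have h : ∀ H ∈ spanningSubgraphs G, weight G p H * ((injHoms F H).card : ℝ) =
      ∑ x ∈ injHoms F G, if (edgeImage F x : Set (Sym2 V)) ⊆ H.edgeSet then weight G p H else 0 := by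
    intro H hH
    rw [mem_spanningSubgraphs] at hH
    rw [← Finset.sum_filter, Finset.sum_const, nsmul_eq_mul, mul_comm]
    congr 3
    ext x
    rw [Finset.mem_filter, mem_injHoms_iff_edgeImage hH]
  rw [expect, Finset.sum_congr rfl h, Finset.sum_comm]
  have h2 : ∀ x ∈ injHoms F G, ∑ H ∈ spanningSubgraphs G,
      (if (edgeImage F x : Set (Sym2 V)) ⊆ H.edgeSet then weight G p H else 0) =
        p ^ F.edgeSet.ncard := by
    intro x hx
    rw [← Finset.sum_filter, sum_weight_superset G p _ (edgeImage_subset_of_mem hx),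
      card_edgeImage (mem_injHoms.1 hx).2]
  rw [Finset.sum_congr rfl h2, Finset.sum_const, nsmul_eq_mul]

open Classical in
theorem expect_card_injHoms_sq (F : SimpleGraph W) (G : SimpleGraph V) (p : ℝ) :
    expect G p (fun H => ((injHoms F H).card : ℝ) ^ 2) =
      ∑ z ∈ injHoms F G ×ˢ injHoms F G, p ^ (edgeImage F z.1 ∪ edgeImage F z.2).card := by
  have h : ∀ H ∈ spanningSubgraphs G, weight G p H * ((injHoms F H).card : ℝ) ^ 2 =
      ∑ z ∈ injHoms F G ×ˢ injHoms F G,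
        if ((edgeImage F z.1 ∪ edgeImage F z.2 : Finset (Sym2 V)) : Set (Sym2 V)) ⊆ H.edgeSet
          then weight G p H else 0 := by
    intro H hH
    rw [mem_spanningSubgraphs] at hH
    rw [← Finset.sum_filter, Finset.sum_const, nsmul_eq_mul, mul_comm]
    congr 1
    rw [sq, ← Nat.cast_mul, ← Finset.card_product]
    congr 2
    ext z
    rw [Finset.mem_filter, Finset.mem_product, Finset.mem_product, mem_injHoms_iff_edgeImage hH,
      mem_injHoms_iff_edgeImage hH, Finset.coe_union, Set.union_subset_iff]
    tauto
  rw [expect, Finset.sum_congr rfl h, Finset.sum_comm]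
  refine Finset.sum_congr rfl fun z hz => ?_
  rw [Finset.mem_product] at hz
  rw [← Finset.sum_filter, sum_weight_superset]
  rw [Finset.coe_union]
  exact Set.union_subset (edgeImage_subset_of_mem hz.1) (edgeImage_subset_of_mem hz.2)

open Classical in
/-- The variance is at most the contribution of the pairs of maps that share an edge. -/
theorem expect_sq_sub_le (F : SimpleGraph W) (G : SimpleGraph V) (p : ℝ) :
    expect G p (fun H => ((injHoms F H).card : ℝ) ^ 2) -
        expect G p (fun H => ((injHoms F H).card : ℝ)) ^ 2 ≤
      ∑ z ∈ (injHoms F G ×ˢ injHoms F G).filter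
        (fun z => ¬ Disjoint (edgeImage F z.1) (edgeImage F z.2)),
          p ^ (edgeImage F z.1 ∪ edgeImage F z.2).card := by
  rw [expect_card_injHoms_sq, expect_card_injHoms, mul_pow, ← Nat.cast_pow, sq (Finset.card _),
    ← Finset.card_product, ← nsmul_eq_mul, ← Finset.sum_const,
    ← Finset.sum_filter_add_sum_filter_not (injHoms F G ×ˢ injHoms F G)
      (fun z => Disjoint (edgeImage F z.1) (edgeImage F z.2))
      (fun z => p ^ (edgeImage F z.1 ∪ edgeImage F z.2).card),
    add_comm, add_sub_assoc]
  -- Edge-disjoint pairs contribute p^(2e(F)) each, hence together at most the squared mean, which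
  -- sums this over all pairs.
  refine add_le_of_nonpos_right (sub_nonpos.2 ?_)
  refine le_trans (le_of_eq (Finset.sum_congr rfl fun z hz => ?_))
    (Finset.sum_le_sum_of_subset_of_nonneg (Finset.filter_subset _ _) fun _ _ _ => sq_nonneg _)
  rw [Finset.mem_filter, Finset.mem_product, mem_injHoms, mem_injHoms] at hz
  rw [Finset.card_union_of_disjoint hz.2, card_edgeImage hz.1.1.2, card_edgeImage hz.1.2.2,
    ← pow_mul, mul_two]

end Moments

/-! ### Overlapping pairs of embeddings, classified by their identification pattern. -/

section Gluing

variable {W : Type*} [Fintype W]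

/-- The union of two copies of `F` whose union covers all vertices, and their intersection. -/
theorem exists_subgraph_of_gluing {Q : Type*} [Finite Q] (F : SimpleGraph W) (π₁ π₂ : W ↪ Q)
    (hsurj : Set.range π₁ ∪ Set.range π₂ = Set.univ) :
    ∃ H : F.Subgraph, Nat.card Q + H.verts.ncard = 2 * Fintype.card W ∧
      (F.map π₁ ⊔ F.map π₂).edgeSet.ncard + H.edgeSet.ncard = 2 * F.edgeSet.ncard ∧
      (((F.map π₁).edgeSet ∩ (F.map π₂).edgeSet).Nonempty → H.edgeSet.Nonempty) := by
  -- The intersection of the two copies, pulled back along the first; both counts are then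
  -- inclusion–exclusion.
  let H : F.Subgraph :=
    { verts := π₁ ⁻¹' Set.range π₂
      Adj := fun a b => F.Adj a b ∧ (F.map π₂).Adj (π₁ a) (π₁ b)
      adj_sub := fun h => h.1
      edge_vert := by
        rintro a b ⟨_, h⟩
        rw [SimpleGraph.map_adj] at h
        obtain ⟨u, v, _, h1, _⟩ := h
        exact ⟨u, h1⟩
      symm := ⟨fun a b h => ⟨h.1.symm, h.2.symm⟩⟩ }
  have hcardF : ∀ π : W ↪ Q, (F.map π).edgeSet.ncard = F.edgeSet.ncard := by
    intro π
    rw [SimpleGraph.edgeSet_map, Set.ncard_image_of_injective _ π.sym2Map.injective]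
  have hedge : (F.map π₁).edgeSet ∩ (F.map π₂).edgeSet = π₁.sym2Map '' H.edgeSet := by
    rw [SimpleGraph.edgeSet_map π₁ F]
    ext e
    constructor
    · rintro ⟨⟨e, he, rfl⟩, h2⟩
      refine ⟨e, ?_, rfl⟩
      induction e with
      | _ a b => exact ⟨he, h2⟩
    · rintro ⟨e, he, rfl⟩
      induction e with
      | _ a b => exact ⟨⟨s(a, b), he.1, rfl⟩, he.2⟩
  refine ⟨H, ?_, ?_, ?_⟩
  · have h := Set.ncard_union_add_ncard_inter (Set.range π₁) (Set.range π₂)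
    have hr : ∀ π : W ↪ Q, (Set.range π).ncard = Fintype.card W := by
      intro π
      rw [← Set.image_univ, Set.ncard_image_of_injective _ π.injective, Set.ncard_univ,
        Nat.card_eq_fintype_card]
    have hi : Set.range π₁ ∩ Set.range π₂ = π₁ '' H.verts := by
      rw [Set.inter_comm, ← Set.image_preimage_eq_inter_range]
    rw [hr, hr, hsurj, Set.ncard_univ, hi, Set.ncard_image_of_injective _ π₁.injective] at h
    omega
  · have h := Set.ncard_union_add_ncard_inter (F.map π₁).edgeSet (F.map π₂).edgeSet
    rw [hcardF, hcardF, hedge, Set.ncard_image_of_injective _ π₁.sym2Map.injective,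
      ← SimpleGraph.edgeSet_sup] at h
    omega
  · intro h
    rw [hedge] at h
    exact h.of_image

theorem finite_setoid (α : Type*) [Finite α] : Finite (Setoid α) :=
  Finite.of_injective (fun s : Setoid α => fun a b => s a b) fun s t h => by
    ext a b
    exact iff_of_eq (congrFun (congrFun h a) b)

/-- The left copy of the vertex set in a quotient of the disjoint union of two copies. -/
def leftMap (r : Setoid (W ⊕ W)) (w : W) : Quotient r := Quotient.mk r (Sum.inl w)

/-- The right copy of the vertex set in a quotient of the disjoint union of two copies. -/
def rightMap (r : Setoid (W ⊕ W)) (w : W) : Quotient r := Quotient.mk r (Sum.inr w)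

/-- The union of the two copies of `F` in a quotient of the disjoint union of the vertex sets. -/
def glued (F : SimpleGraph W) (r : Setoid (W ⊕ W)) : SimpleGraph (Quotient r) :=
  F.map (leftMap r) ⊔ F.map (rightMap r)

/-- The two copies of `F` are embedded in the quotient and have an edge in common. -/
def IsOverlap (F : SimpleGraph W) (r : Setoid (W ⊕ W)) : Prop :=
  Function.Injective (leftMap r) ∧ Function.Injective (rightMap r) ∧
    ((F.map (leftMap r)).edgeSet ∩ (F.map (rightMap r)).edgeSet).Nonempty

theorem IsOverlap.exists_subgraph {F : SimpleGraph W} {r : Setoid (W ⊕ W)} (h : IsOverlap F r) :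
    ∃ H : F.Subgraph, Nat.card (Quotient r) + H.verts.ncard = 2 * Fintype.card W ∧
      (glued F r).edgeSet.ncard + H.edgeSet.ncard = 2 * F.edgeSet.ncard ∧
      H.edgeSet.Nonempty := by
  obtain ⟨H, h1, h2, h3⟩ := exists_subgraph_of_gluing F ⟨leftMap r, h.1⟩ ⟨rightMap r, h.2.1⟩ (by
    ext q
    induction q using Quotient.inductionOn with
    | _ z =>
    rcases z with w | w
    · simpa using Or.inl ⟨w, rfl⟩
    · simpa using Or.inr ⟨w, rfl⟩)
  exact ⟨H, h1, h2, h3 h.2.2⟩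

variable {V : Type*} [Fintype V] {F : SimpleGraph W} {G : SimpleGraph V}

/-- The common factor of two maps through the quotient by their joint kernel. -/
def jointLift (x y : W → V) : Quotient (Setoid.ker (Sum.elim x y)) → V :=
  Quotient.lift (Sum.elim x y) fun _ _ h => h

theorem jointLift_injective {W V : Type*} (x y : W → V) : Function.Injective (jointLift x y) := by
  intro a b
  induction a using Quotient.inductionOn
  induction b using Quotient.inductionOn
  intro h
  exact Quotient.sound h

theorem leftMap_injective {W V : Type*} {x y : W → V} (hx : Function.Injective x) :
    Function.Injective (leftMap (Setoid.ker (Sum.elim x y))) := by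
  intro a b h
  exact hx (congrArg (jointLift x y) h)

theorem rightMap_injective {W V : Type*} {x y : W → V} (hy : Function.Injective y) :
    Function.Injective (rightMap (Setoid.ker (Sum.elim x y))) := by
  intro a b h
  exact hy (congrArg (jointLift x y) h)

theorem edgeSet_map_of_injective {W Q : Type*} (F : SimpleGraph W) {π : W → Q}
    (hπ : Function.Injective π) : (F.map π).edgeSet = Sym2.map π '' F.edgeSet :=
  SimpleGraph.edgeSet_map ⟨π, hπ⟩ F

theorem image_edgeSet_leftMap {V : Type*} {x y : W → V} (hx : Function.Injective x) :
    Sym2.map (jointLift x y) '' (F.map (leftMap (Setoid.ker (Sum.elim x y)))).edgeSet =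
      edgeImage F x := by
  rw [edgeSet_map_of_injective F (leftMap_injective hx), coe_edgeImage, ← Set.image_comp,
    ← Sym2.map_comp]
  rfl

theorem image_edgeSet_rightMap {V : Type*} {x y : W → V} (hy : Function.Injective y) :
    Sym2.map (jointLift x y) '' (F.map (rightMap (Setoid.ker (Sum.elim x y)))).edgeSet =
      edgeImage F y := by
  rw [edgeSet_map_of_injective F (rightMap_injective hy), coe_edgeImage, ← Set.image_comp,
    ← Sym2.map_comp]
  rfl

open Classical in
theorem image_edgeSet_glued {V : Type*} {x y : W → V} (hx : Function.Injective x)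
    (hy : Function.Injective y) :
    Sym2.map (jointLift x y) '' (glued F (Setoid.ker (Sum.elim x y))).edgeSet =
      (edgeImage F x ∪ edgeImage F y : Finset (Sym2 V)) := by
  rw [glued, SimpleGraph.edgeSet_sup, Set.image_union, image_edgeSet_leftMap hx,
    image_edgeSet_rightMap hy, Finset.coe_union]

open Classical in
/-- The pairs of injective homomorphisms that share an edge and have a given joint kernel. -/
noncomputable def overlappingPairs (F : SimpleGraph W) (G : SimpleGraph V) (r : Setoid (W ⊕ W)) :
    Finset ((W → V) × (W → V)) :=
  ((injHoms F G ×ˢ injHoms F G).filter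
    (fun z => ¬ Disjoint (edgeImage F z.1) (edgeImage F z.2))).filter
      fun z => Setoid.ker (Sum.elim z.1 z.2) = r

theorem mem_overlappingPairs {r : Setoid (W ⊕ W)} {z : (W → V) × (W → V)} :
    z ∈ overlappingPairs F G r ↔ ((z.1 ∈ injHoms F G ∧ z.2 ∈ injHoms F G) ∧
      ¬ Disjoint (edgeImage F z.1) (edgeImage F z.2)) ∧ Setoid.ker (Sum.elim z.1 z.2) = r := by
  simp [overlappingPairs]

theorem isOverlap_of_mem {r : Setoid (W ⊕ W)} {z : (W → V) × (W → V)}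
    (hz : z ∈ overlappingPairs F G r) : IsOverlap F r := by
  rw [mem_overlappingPairs] at hz
  obtain ⟨⟨⟨hx, hy⟩, hd⟩, rfl⟩ := hz
  have hx' := (mem_injHoms.1 hx).2
  have hy' := (mem_injHoms.1 hy).2
  refine ⟨leftMap_injective hx', rightMap_injective hy', ?_⟩
  rw [Finset.not_disjoint_iff] at hd
  obtain ⟨e, h1, h2⟩ := hd
  rw [← Finset.mem_coe, ← image_edgeSet_leftMap hx' (y := z.2)] at h1
  rw [← Finset.mem_coe, ← image_edgeSet_rightMap hy' (x := z.1)] at h2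
  obtain ⟨a, ha, rfl⟩ := h1
  obtain ⟨b, hb, hab⟩ := h2
  rw [Sym2.map.injective (jointLift_injective _ _) hab] at hb
  exact ⟨a, ha, hb⟩

open Classical in
theorem card_union_edgeImage_of_mem {r : Setoid (W ⊕ W)} {z : (W → V) × (W → V)}
    (hz : z ∈ overlappingPairs F G r) :
    (edgeImage F z.1 ∪ edgeImage F z.2).card = (glued F r).edgeSet.ncard := by
  rw [mem_overlappingPairs] at hz
  obtain ⟨⟨⟨hx, hy⟩, -⟩, rfl⟩ := hz
  rw [← Set.ncard_coe_finset, ← image_edgeSet_glued (mem_injHoms.1 hx).2 (mem_injHoms.1 hy).2,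
    Set.ncard_image_of_injective _ (Sym2.map.injective (jointLift_injective _ _))]

/-- A pair with joint kernel r factors through the quotient, and the factor is a homomorphism from
the glued graph that determines the pair. -/
theorem card_overlappingPairs_le (r : Setoid (W ⊕ W)) [Fintype (Quotient r)] :
    (overlappingPairs F G r).card ≤ (homs (glued F r) G).card := by
  classical
  refine Finset.card_le_card_of_surjOn
    (fun h => (fun w => h (leftMap r w), fun w => h (rightMap r w))) ?_
  intro z hz
  rw [Finset.mem_coe, mem_overlappingPairs] at hz
  obtain ⟨⟨⟨hx, hy⟩, -⟩, rfl⟩ := hz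
  refine ⟨jointLift z.1 z.2, ?_, rfl⟩
  rw [Finset.mem_coe, mem_homs]
  rw [mem_injHoms] at hx hy
  rintro i j (⟨_, u, v, huv, rfl, rfl⟩ | ⟨_, u, v, huv, rfl, rfl⟩)
  · exact hx.1 u v huv
  · exact hy.1 u v huv

/-- The variance of the number of injective homomorphisms, in terms of the overlaps. -/
theorem expect_sq_sub_le_finsum (F : SimpleGraph W) (G : SimpleGraph V) (p : ℝ) :
    expect G p (fun H => ((injHoms F H).card : ℝ) ^ 2) -
        expect G p (fun H => ((injHoms F H).card : ℝ)) ^ 2 ≤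
      ∑ᶠ r : Setoid (W ⊕ W), (overlappingPairs F G r).card * p ^ (glued F r).edgeSet.ncard := by
  classical
  have := finite_setoid (W ⊕ W)
  have := Fintype.ofFinite (Setoid (W ⊕ W))
  rw [finsum_eq_sum_of_fintype]
  refine (expect_sq_sub_le F G p).trans (le_of_eq ?_)
  -- The joint kernel records which vertices of the two copies coincide. It has finitely many
  -- values, independently of the host graph.
  rw [← Finset.sum_fiberwise (g := fun z : (W → V) × (W → V) => Setoid.ker (Sum.elim z.1 z.2))]
  refine Finset.sum_congr rfl fun r _ => ?_
  rw [← nsmul_eq_mul, ← Finset.sum_const]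
  refine Finset.sum_congr (by ext z; simp [overlappingPairs]) fun z hz => ?_
  rw [card_union_edgeImage_of_mem (r := r)]
  simpa [overlappingPairs] using hz

end Gluing

/-! ### Copies versus embeddings. -/

section Copies

variable {W V : Type*} [Fintype W] [Fintype V]

theorem card_injHoms_eq_card_copy (F : SimpleGraph W) (G : SimpleGraph V) :
    (injHoms F G).card = Nat.card (F.Copy G) := by
  rw [← Nat.card_eq_finsetCard]
  refine Nat.card_congr
    { toFun := fun x => ⟨⟨x.1, fun {i j} h => (mem_injHoms.1 x.2).1 i j h⟩, (mem_injHoms.1 x.2).2⟩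
      invFun := fun f => ⟨f, mem_injHoms.2 ⟨fun _ _ h => f.toHom.map_adj h, f.injective⟩⟩
      left_inv := fun _ => rfl
      right_inv := fun _ => rfl }

/-- An embedding amounts to its image subgraph with an isomorphism from F onto it, and these
isomorphisms form a torsor under the automorphisms of F. -/
theorem card_copy_eq (F : SimpleGraph W) (G : SimpleGraph V) :
    Nat.card (F.Copy G) = G.copyCount F * Nat.card (F ≃g F) := by
  classical
  let S := {G' : G.Subgraph // Nonempty (F ≃g G'.coe)}
  have h1 : G.copyCount F = Nat.card S := by
    rw [SimpleGraph.copyCount, ← Fintype.card_subtype, Nat.card_eq_fintype_card]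
  let Φ : (Σ G' : S, F ≃g G'.1.coe) → F.Copy G := fun t =>
    ⟨t.1.1.hom.comp t.2.toHom, SimpleGraph.Subgraph.hom_injective.comp t.2.injective⟩
  have hsub : ∀ t, (Φ t).toSubgraph = t.1.1 := by
    intro t
    simp [Φ, SimpleGraph.Copy.toSubgraph, SimpleGraph.Subgraph.map_comp]
  have hΦ : Function.Bijective Φ := by
    constructor
    · rintro ⟨⟨G₁, h₁⟩, e₁⟩ ⟨⟨G₂, h₂⟩, e₂⟩ h
      have h3 := hsub ⟨⟨G₁, h₁⟩, e₁⟩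
      rw [h, hsub] at h3
      obtain rfl : G₂ = G₁ := h3
      congr 1
      ext w
      exact DFunLike.congr_fun h w
    · intro f
      refine ⟨⟨⟨f.toSubgraph, ⟨f.isoToSubgraph⟩⟩, f.isoToSubgraph⟩, ?_⟩
      ext w
      rfl
  have h2 : ∀ G' : S, Nat.card (F ≃g G'.1.coe) = Nat.card (F ≃g F) := by
    intro G'
    obtain ⟨e⟩ := G'.2
    exact Nat.card_congr
      { toFun := fun f => f.trans e.symm
        invFun := fun f => f.trans e
        left_inv := fun f => by ext; simp
        right_inv := fun f => by ext; simp }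
  have h3 : ∀ G' : S, Finite (F ≃g G'.1.coe) := fun G' =>
    Finite.of_injective (fun f : F ≃g G'.1.coe => (f : W → G'.1.verts)) DFunLike.coe_injective
  rw [← Nat.card_congr (Equiv.ofBijective Φ hΦ), Nat.card_sigma, h1]
  simp_rw [h2]
  rw [Finset.sum_const, Finset.card_univ, smul_eq_mul, ← Nat.card_eq_fintype_card]

theorem card_automorphisms_pos (F : SimpleGraph W) : 0 < Nat.card (F ≃g F) := by
  have : Finite (F ≃g F) := Finite.of_injective (fun f : F ≃g F => (f : W → W)) DFunLike.coe_injective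
  have : Nonempty (F ≃g F) := ⟨SimpleGraph.Iso.refl⟩
  exact Nat.card_pos

theorem numCopies_eq (F : SimpleGraph W) (H : SimpleGraph V) :
    numCopies F H = ((injHoms F H).card : ℝ) / Nat.card (F ≃g F) := by
  have h := card_automorphisms_pos F
  rw [numCopies, card_injHoms_eq_card_copy, card_copy_eq, Nat.cast_mul, mul_div_cancel_right₀]
  exact_mod_cast h.ne'

/-- The number of automorphisms cancels, so concentration can be proved for embeddings. -/
theorem numCopies_div_expect (F : SimpleGraph W) (G : SimpleGraph V) (p : ℝ) (H : SimpleGraph V) :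
    numCopies F H / expect G p (numCopies F) =
      ((injHoms F H).card : ℝ) / expect G p (fun H => ((injHoms F H).card : ℝ)) := by
  have h : ((Nat.card (F ≃g F) : ℕ) : ℝ) ≠ 0 := by exact_mod_cast (card_automorphisms_pos F).ne'
  have h2 : expect G p (numCopies F) =
      expect G p (fun H => ((injHoms F H).card : ℝ)) / Nat.card (F ≃g F) := by
    unfold expect
    rw [Finset.sum_div]
    exact Finset.sum_congr rfl fun H _ => by rw [numCopies_eq, mul_div_assoc]
  rw [h2, numCopies_eq, div_div_div_cancel_right₀ h]

end Copies

/-! ### The maximal density and a subgraph attaining it. -/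

section Density

variable {W : Type*} [Fintype W] {F : SimpleGraph W}

theorem ncard_edgeSet_le_maxDensity_mul (H : F.Subgraph) (hH : H.verts.Nonempty) :
    (H.edgeSet.ncard : ℝ) ≤ maxDensity F * H.verts.ncard := by
  have hpos : (0 : ℝ) < H.verts.ncard := by
    exact_mod_cast (Set.ncard_pos (Set.toFinite _)).2 hH
  rw [← div_le_iff₀ hpos]
  exact le_ciSup (f := fun H : {H : F.Subgraph // H.verts.Nonempty} =>
    (H.1.edgeSet.ncard : ℝ) / (H.1.verts.ncard : ℝ)) (Set.finite_range _).bddAbove ⟨H, hH⟩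

theorem maxDensity_pos (hF : F ≠ ⊥) : 0 < maxDensity F := by
  obtain ⟨a, b, hab⟩ : ∃ a b, F.Adj a b := by
    by_contra! h
    exact hF (by ext a b; simp [h a b])
  have h := ncard_edgeSet_le_maxDensity_mul (F := F) ⊤ ⟨a, Set.mem_univ a⟩
  have he : 0 < (⊤ : F.Subgraph).edgeSet.ncard :=
    (Set.ncard_pos (Set.toFinite _)).2 ⟨s(a, b), hab⟩
  have he' : (0 : ℝ) < (⊤ : F.Subgraph).edgeSet.ncard := by exact_mod_cast he
  exact pos_of_mul_pos_left (he'.trans_le h) (by positivity)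

theorem exists_subgraph_maxDensity (hF : F ≠ ⊥) :
    ∃ H : F.Subgraph, (H.edgeSet.ncard : ℝ) = maxDensity F * H.verts.ncard ∧
      H.edgeSet.ncard ≠ 0 := by
  have hne : Nonempty W := by
    by_contra h
    rw [not_nonempty_iff] at h
    exact hF (by ext a; exact h.elim a)
  have : Nonempty {H : F.Subgraph // H.verts.Nonempty} :=
    ⟨⟨⊤, ⟨Classical.arbitrary W, Set.mem_univ _⟩⟩⟩
  obtain ⟨H, hH⟩ := exists_eq_ciSup_of_finite (f := fun H : {H : F.Subgraph // H.verts.Nonempty} =>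
    (H.1.edgeSet.ncard : ℝ) / (H.1.verts.ncard : ℝ))
  have hpos : (0 : ℝ) < H.1.verts.ncard := by
    exact_mod_cast (Set.ncard_pos (Set.toFinite _)).2 H.2
  have h1 : (H.1.edgeSet.ncard : ℝ) = maxDensity F * H.1.verts.ncard := by
    rw [← div_eq_iff hpos.ne']; exact hH
  refine ⟨H.1, h1, fun h0 => ?_⟩
  rw [h0, Nat.cast_zero] at h1
  exact (mul_pos (maxDensity_pos hF) hpos).ne h1

theorem ncard_edgeSet_coe {W : Type*} {F : SimpleGraph W} (H : F.Subgraph) : H.coe.edgeSet.ncard = H.edgeSet.ncard := by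
  rw [← SimpleGraph.Subgraph.image_coe_edgeSet_coe,
    Set.ncard_image_of_injective _ (Sym2.map.injective Subtype.val_injective)]

end Density

/-! ### The two sides of the threshold and concentration. -/

section Threshold

variable {W : Type*} [Fintype W] {F : SimpleGraph W} {p : ℕ → ℝ}

theorem numVertices_pos (n : ℕ) : 0 < numVertices n := Nat.choose_pos (Nat.div_le_self _ _)

theorem sqrt_log_numVertices_pos {n : ℕ} (hn : 4 ≤ n) : 0 < √(Real.log (numVertices n)) := by
  have h1 := sqrt_le_two_mul_sqrt_log_numVertices hn
  have h2 : 0 < √(n : ℝ) := Real.sqrt_pos.2 (by exact_mod_cast (by omega : 0 < n))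
  linarith

theorem homOrder_pos {n : ℕ} (hn : 4 ≤ n) (v e : ℕ) : 0 < homOrder v e n := by
  have h1 := sqrt_log_numVertices_pos hn
  have h2 : (0 : ℝ) < numVertices n := by exact_mod_cast numVertices_pos n
  unfold homOrder
  positivity

theorem homOrder_mul_homOrder (v e v' e' n : ℕ) :
    homOrder v e n * homOrder v' e' n = homOrder (v + v') (e + e') n := by
  simp only [homOrder]
  rw [div_mul_div_comm, ← pow_add, ← pow_add]

theorem threshold_pos {W : Type*} (F : SimpleGraph W) {n : ℕ} (hn : 4 ≤ n) : 0 < threshold F n := by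
  have h1 := sqrt_log_numVertices_pos hn
  have h2 : (0 : ℝ) < numVertices n := by exact_mod_cast numVertices_pos n
  unfold threshold
  positivity

/-- The order of the expected number of copies of a graph with `v` vertices and `e` edges, in terms
of the ratio of the edge probability to the threshold. -/
theorem homOrder_mul_pow {W : Type*} (F : SimpleGraph W) {n : ℕ} (hn : 4 ≤ n) (v e : ℕ)
    (q : ℝ) :
    homOrder v e n * q ^ e =
      (numVertices n : ℝ) ^ (v - e / maxDensity F : ℝ) * (q / threshold F n) ^ e := by
  have h1 := sqrt_log_numVertices_pos hn
  have h2 : (0 : ℝ) < numVertices n := by exact_mod_cast numVertices_pos n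
  have h3 : ((numVertices n : ℝ) ^ (-1 / maxDensity F)) ^ e =
      (numVertices n : ℝ) ^ (-(e / maxDensity F)) := by
    rw [← Real.rpow_natCast, ← Real.rpow_mul h2.le]
    congr 1
    ring
  rw [homOrder, threshold, div_pow, mul_pow, h3, sub_eq_add_neg, Real.rpow_add h2,
    Real.rpow_natCast]
  have h4 : 0 < (numVertices n : ℝ) ^ (-(e / maxDensity F)) := by positivity
  field_simp

theorem eventually_four_le : ∀ᶠ n in toInfinity, 4 ≤ n :=
  toInfinity_le_atTop (eventually_ge_atTop 4)

/-- A copy of F contains a copy of its densest subgraph H. For H the power of N in the first moment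
vanishes, leaving a constant times (p/p*)^e(H). -/
theorem tendsto_prob_isContained_zero (hF : F ≠ ⊥) (hp : ∀ n, p n ∈ Set.Icc (0 : ℝ) 1)
    (h : p =o[toInfinity] threshold F) :
    Tendsto (fun n => prob (graph n) (p n) fun H => F ⊑ H) toInfinity (𝓝 0) := by
  classical
  obtain ⟨H, hH, he⟩ := exists_subgraph_maxDensity hF
  obtain ⟨C, hC, hle⟩ := exists_card_homs_le H.coe
  rw [ncard_edgeSet_coe] at hle
  have hlim : Tendsto (fun n => C * (p n / threshold F n) ^ H.edgeSet.ncard) toInfinity (𝓝 0) := by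
    have := (h.tendsto_div_nhds_zero.pow H.edgeSet.ncard).const_mul C
    rwa [zero_pow he, mul_zero] at this
  refine squeeze_zero' (Eventually.of_forall fun n => prob_nonneg (hp n) _) ?_ hlim
  filter_upwards [hle, eventually_four_le] with n hn hn4
  have h1 : prob (graph n) (p n) (fun H => F ⊑ H) ≤
      expect (graph n) (p n) (fun G => ((injHoms H.coe G).card : ℝ)) := by
    refine prob_le_expect (hp n) (fun _ => by positivity) fun G _ hG => ?_
    have h2 : H.coe ⊑ G := H.coe_isContained.trans hG
    obtain ⟨f⟩ := h2
    have h3 : (f : H.verts → _) ∈ injHoms H.coe G :=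
      mem_injHoms.2 ⟨fun _ _ h => f.toHom.map_adj h, f.injective⟩
    exact_mod_cast Finset.card_pos.2 ⟨_, h3⟩
  have h0 := (hp n).1
  refine h1.trans ?_
  rw [expect_card_injHoms, ncard_edgeSet_coe]
  have hcard : ((injHoms H.coe (graph n)).card : ℝ) ≤
      C * homOrder (Fintype.card H.verts) H.edgeSet.ncard n :=
    le_trans (Nat.cast_le.2 (card_injHoms_le _ _)) hn
  have hv : Fintype.card H.verts = H.verts.ncard := by
    rw [← Nat.card_eq_fintype_card, Nat.card_coe_set_eq]
  calc _ ≤ C * homOrder (Fintype.card H.verts) H.edgeSet.ncard n * p n ^ H.edgeSet.ncard := by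
        gcongr
    _ = C * (p n / threshold F n) ^ H.edgeSet.ncard := by
        rw [mul_assoc, homOrder_mul_pow F hn4, hv, hH,
          mul_div_cancel_left₀ _ (maxDensity_pos hF).ne', sub_self, Real.rpow_zero, one_mul]

theorem tendsto_div_threshold {W : Type*} {F : SimpleGraph W}
    (hp : ∀ n, p n ∈ Set.Icc (0 : ℝ) 1) (h : threshold F =o[toInfinity] p) :
    Tendsto (fun n => p n / threshold F n) toInfinity atTop := by
  have h1 : Tendsto (fun n => threshold F n / p n) toInfinity (𝓝[>] 0) := by
    refine tendsto_nhdsWithin_iff.2 ⟨h.tendsto_div_nhds_zero, ?_⟩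
    filter_upwards [h.bound one_pos, eventually_four_le] with n hn hn4
    have ht := threshold_pos F hn4
    have h0 : p n ≠ 0 := by
      intro h0
      rw [h0, norm_zero, mul_zero] at hn
      exact (norm_pos_iff.2 ht.ne').not_ge hn
    exact div_pos ht (lt_of_le_of_ne (hp n).1 h0.symm)
  refine h1.inv_tendsto_nhdsGT_zero.congr fun n => ?_
  simp

/-- Each overlap pattern contributes O(p*/p) to the relative variance. -/
theorem tendsto_card_overlappingPairs (hF : F ≠ ⊥) (hp : ∀ n, p n ∈ Set.Icc (0 : ℝ) 1)
    (h : threshold F =o[toInfinity] p) (r : Setoid (W ⊕ W)) :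
    Tendsto (fun n => ((overlappingPairs F (graph n) r).card * p n ^ (glued F r).edgeSet.ncard) /
          expect (graph n) (p n) (fun H => ((injHoms F H).card : ℝ)) ^ 2) toInfinity (𝓝 0) := by
  classical
  by_cases hr : IsOverlap F r
  · obtain ⟨H, hv, he, hne⟩ := hr.exists_subgraph
    rw [Nat.card_eq_fintype_card] at hv
    obtain ⟨C, hC, hup⟩ := exists_card_homs_le (glued F r)
    obtain ⟨c, hc, hlow⟩ := exists_le_card_injHoms F
    have hy := tendsto_div_threshold hp h
    have hlim : Tendsto (fun n => C / c ^ 2 * (p n / threshold F n)⁻¹) toInfinity (𝓝 0) := by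
      have := (tendsto_inv_atTop_zero.comp hy).const_mul (C / c ^ 2)
      rwa [mul_zero] at this
    have hHe : H.edgeSet.ncard ≠ 0 := ((Set.ncard_pos (Set.toFinite _)).2 hne).ne'
    have hHv : H.verts.Nonempty := by
      obtain ⟨e, he⟩ := hne
      induction e with
      | _ a b => exact ⟨a, H.edge_vert he⟩
    have hρ := maxDensity_pos hF
    have hexp : (0 : ℝ) ≤ H.verts.ncard - H.edgeSet.ncard / maxDensity F := by
      rw [sub_nonneg, div_le_iff₀ hρ, mul_comm]
      exact ncard_edgeSet_le_maxDensity_mul H hHv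
    refine squeeze_zero' (Eventually.of_forall fun n => ?_) ?_ hlim
    · have := (hp n).1
      positivity
    · filter_upwards [hup, hlow, eventually_four_le, hy.eventually_ge_atTop 1]
        with n hn1 hn2 hn4 hy1
      set y := p n / threshold F n with hyd
      have ht := threshold_pos F hn4
      have hp0 : 0 < p n := by
        have : p n = y * threshold F n := by rw [hyd]; field_simp
        rw [this]
        positivity
      have hN1 : (1 : ℝ) ≤ numVertices n := by exact_mod_cast numVertices_pos n
      -- Maximality of the density makes the exponent of N nonnegative, and a shared edge supplies
      -- at least one factor y.
      have hH : y ≤ homOrder H.verts.ncard H.edgeSet.ncard n * p n ^ H.edgeSet.ncard := by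
        rw [homOrder_mul_pow F hn4, ← hyd]
        calc y ≤ y ^ H.edgeSet.ncard := le_self_pow₀ hy1 hHe
          _ ≤ _ := le_mul_of_one_le_left (by positivity) (Real.one_le_rpow hN1 hexp)
      set Q := homOrder (Fintype.card (Quotient r)) (glued F r).edgeSet.ncard n *
        p n ^ (glued F r).edgeSet.ncard with hQ
      set B := homOrder (Fintype.card W) F.edgeSet.ncard n * p n ^ F.edgeSet.ncard with hB
      have hBpos : 0 < B := mul_pos (homOrder_pos hn4 _ _) (by positivity)
      have hQpos : 0 < Q := mul_pos (homOrder_pos hn4 _ _) (by positivity)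
      -- Vertices and edges of union and intersection add up to twice those of F, and the orders are
      -- multiplicative.
      have hQH : Q * (homOrder H.verts.ncard H.edgeSet.ncard n * p n ^ H.edgeSet.ncard) =
          B ^ 2 := by
        rw [hQ, hB, mul_mul_mul_comm, homOrder_mul_homOrder, ← pow_add, hv, he, mul_pow, sq,
          homOrder_mul_homOrder, ← pow_mul, two_mul, two_mul, mul_two]
      have hnum : (overlappingPairs F (graph n) r).card * p n ^ (glued F r).edgeSet.ncard ≤
          C * Q := by
        rw [hQ, ← mul_assoc]
        refine mul_le_mul_of_nonneg_right ?_ (by positivity)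
        exact le_trans (Nat.cast_le.2 (card_overlappingPairs_le r)) hn1
      have hden : c * B ≤ expect (graph n) (p n) (fun H => ((injHoms F H).card : ℝ)) := by
        rw [expect_card_injHoms, hB, ← mul_assoc]
        exact mul_le_mul_of_nonneg_right hn2 (by positivity)
      generalize expect (graph n) (p n) (fun H => ((injHoms F H).card : ℝ)) = μ at hden ⊢
      generalize homOrder H.verts.ncard H.edgeSet.ncard n * p n ^ H.edgeSet.ncard = A at hH hQH ⊢
      have hApos : 0 < A := lt_of_lt_of_le (by positivity) hH
      clear_value Q B y
      calc _ ≤ C * Q / (c * B) ^ 2 := by gcongr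
        _ = C / c ^ 2 * A⁻¹ := by
            rw [mul_pow, ← hQH]
            field_simp
        _ ≤ _ := by gcongr
  · refine tendsto_const_nhds.congr fun n => ?_
    have : overlappingPairs F (graph n) r = ∅ := by
      rw [Finset.eq_empty_iff_forall_notMem]
      exact fun z hz => hr (isOverlap_of_mem hz)
    rw [this, Finset.card_empty, Nat.cast_zero, zero_mul, zero_div]

theorem tendsto_finsum_overlappingPairs (hF : F ≠ ⊥) (hp : ∀ n, p n ∈ Set.Icc (0 : ℝ) 1)
    (h : threshold F =o[toInfinity] p) :
    Tendsto (fun n => (∑ᶠ r : Setoid (W ⊕ W),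
        (overlappingPairs F (graph n) r).card * p n ^ (glued F r).edgeSet.ncard) /
          expect (graph n) (p n) (fun H => ((injHoms F H).card : ℝ)) ^ 2) toInfinity (𝓝 0) := by
  have := finite_setoid (W ⊕ W)
  have := Fintype.ofFinite (Setoid (W ⊕ W))
  simp_rw [finsum_eq_sum_of_fintype, Finset.sum_div]
  rw [← Finset.sum_const_zero (s := (Finset.univ : Finset (Setoid (W ⊕ W))))]
  exact tendsto_finsetSum _ fun r _ => tendsto_card_overlappingPairs hF hp h r

theorem tendsto_prob_numCopies (hF : F ≠ ⊥) (hp : ∀ n, p n ∈ Set.Icc (0 : ℝ) 1)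
    (h : threshold F =o[toInfinity] p) {ε : ℝ} (hε : 0 < ε) :
    Tendsto (fun n => prob (graph n) (p n) fun H =>
      |numCopies F H / expect (graph n) (p n) (numCopies F) - 1| < ε) toInfinity (𝓝 1) := by
  simp_rw [numCopies_div_expect]
  have hlim := (tendsto_finsum_overlappingPairs hF hp h).div_const (ε ^ 2)
  rw [zero_div] at hlim
  suffices h0 : Tendsto (fun n => prob (graph n) (p n) fun H => ¬ |((injHoms F H).card : ℝ) /
      expect (graph n) (p n) (fun H => ((injHoms F H).card : ℝ)) - 1| < ε) toInfinity (𝓝 0) by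
    have h1 := h0.const_sub 1
    rw [sub_zero] at h1
    exact h1.congr fun n => (eq_sub_of_add_eq (prob_add_prob_not _ _ _)).symm
  obtain ⟨c, hc, hlow⟩ := exists_le_card_injHoms F
  refine squeeze_zero' (Eventually.of_forall fun n => prob_nonneg (hp n) _) ?_ hlim
  filter_upwards [hlow, eventually_four_le, (tendsto_div_threshold hp h).eventually_gt_atTop 0]
    with n hn hn4 hy
  have hp0 : 0 < p n := by
    have ht := threshold_pos F hn4
    exact (div_pos_iff_of_pos_right ht).1 hy
  have hμ : 0 < expect (graph n) (p n) (fun H => ((injHoms F H).card : ℝ)) := by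
    rw [expect_card_injHoms]
    have h1 := homOrder_pos hn4 (Fintype.card W) F.edgeSet.ncard
    have h2 : 0 < ((injHoms F (graph n)).card : ℝ) := lt_of_lt_of_le (by positivity) hn
    positivity
  refine (prob_not_lt_le (hp n) hε hμ.ne').trans ?_
  refine div_le_div_of_nonneg_right ?_ (by positivity)
  rw [div_sub_one (pow_ne_zero 2 hμ.ne')]
  exact div_le_div_of_nonneg_right (expect_sq_sub_le_finsum F (graph n) (p n)) (sq_nonneg _)

theorem tendsto_prob_isContained_one (hF : F ≠ ⊥) (hp : ∀ n, p n ∈ Set.Icc (0 : ℝ) 1)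
    (h : threshold F =o[toInfinity] p) :
    Tendsto (fun n => prob (graph n) (p n) fun H => F ⊑ H) toInfinity (𝓝 1) := by
  -- With ε = 1 concentration excludes X_F = 0, where the relative deviation is exactly 1.
  refine tendsto_of_tendsto_of_tendsto_of_le_of_le (tendsto_prob_numCopies hF hp h one_pos)
    tendsto_const_nhds (fun n => ?_) fun n => prob_le_one (hp n) _
  refine prob_mono (hp n) fun H _ hH => ?_
  by_contra hcon
  have h0 : numCopies F H = 0 := by
    rw [numCopies, Nat.cast_eq_zero]
    exact SimpleGraph.copyCount_eq_zero.2 hcon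
  rw [h0, zero_div, zero_sub, abs_neg, abs_one] at hH
  exact lt_irrefl _ hH

end Threshold

end RandomDistanceGraph

theorem theorem5 {W : Type*} [Finite W] (F : SimpleGraph W) (hF : F ≠ ⊥) :
    RandomDistanceGraph.IsThresholdProbability (fun _ H => F ⊑ H)
      (RandomDistanceGraph.threshold F) ∧
    ∀ p : ℕ → ℝ, (∀ n, p n ∈ Set.Icc (0 : ℝ) 1) →
      RandomDistanceGraph.threshold F =o[RandomDistanceGraph.toInfinity] p →
      ∀ ε : ℝ, 0 < ε →
        Tendsto
          (fun n => RandomDistanceGraph.prob (RandomDistanceGraph.graph n) (p n) fun H =>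
            |RandomDistanceGraph.numCopies F H /
              RandomDistanceGraph.expect (RandomDistanceGraph.graph n) (p n)
                (RandomDistanceGraph.numCopies F) - 1| < ε)
          RandomDistanceGraph.toInfinity (𝓝 1) := by
  have := Fintype.ofFinite W
  exact ⟨⟨fun _ hp h => RandomDistanceGraph.tendsto_prob_isContained_zero hF hp h,
    fun _ hp h => RandomDistanceGraph.tendsto_prob_isContained_one hF hp h⟩,
    fun _ hp h _ hε => RandomDistanceGraph.tendsto_prob_numCopies hF hp h hε⟩
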